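/- All matrices have integer entries. An $n\times m$ matrix $H$ is in Hermite normal form if it is upper triangular ($h_{ij}=0$ for $i>j$) and, for some $r\le n$: the nonzero rows of $H$ are exactly its first $r$ rows; for each $i\le r$ the first nonzero entry $h_{ij_i}$ of row $i$ is positive, and $j_1<j_2<\dots<j_r$; and $0\le h_{kj_i}<h_{ij_i}$ for all $1\le k<i\le r$. For every $A\in\mathbb Z^{n\times m}$ there is a unique $H=\mathrm{HNF}(A)$ in Hermite normal form with $A=UH$ for some $U\in\mathrm{GL}_n(\mathbb Z)$. For $k\le\min(n,m)$ and $d_1,\dots,d_k\in\mathbb N=\{0,1,2,\dots\}$, let $\Delta_{d_1,\dots,d_k}\subseteq\mathbb Z^{n\times m}$ be the set of matrices $A$ such that the $i$-th diagonal entry of $\mathrm{HNF}(A)$ equals $d_i$ for $i=1,\dots,k$. A set $S\subseteq\mathbb Z^N$ has natural density $\mathbb D(S)=\delta$ if for every $z\in\mathbb Z^N$ $$\lim_{B\to\infty}\frac{\bigl|S\cap\prod_{i=1}^N[z_i-B,z_i+B)\bigr|}{(2B)^N}=\delta ,$$ where $B$ runs over the positive reals; subsets of $\mathbb Z^{n\times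 m}$ are regarded as subsets of $\mathbb Z^{nm}$. **Proposition.** Let $n,m$ be positive integers. 1. Let $k$ be a positive integer with $k\le m$ if $m<n$, and $k<n$ if $n\le m$, and let $d_1,\dots,d_k\in\mathbb N$. If $d_k=0$, then $\Delta_{d_1,\dots,d_k}$ has a natural density, and $$\mathbb D(\Delta_{d_1,\dots,d_k})=0 .$$ If $d_i\ne0$ for all $i=1,\dots,k$, then $\Delta_{d_1,\dots,d_k}$ has a natural density, and $$\mathbb D(\Delta_{d_1,\dots,d_k})=\Bigl(\zeta(n)\,\zeta(n-1)\cdots\zeta(n-k+1)\cdot d_1^{\,n}d_2^{\,n-1}\cdots d_k^{\,n-k+1}\Bigr)^{-1},$$ where $\zeta$ is the Riemann zeta function. 2. Suppose $n\le m$, and let $d_1,\dots,d_{n-1}\in\mathbb N$ and integers $0\le r<d$ be given. Then $\Delta_{d_1,\dots,d_{n-1}}$ and $\bigcup_{a\in\mathbb N,\ a\equiv r\ (\mathrm{mod}\ d)}\Delta_{d_1,\dots,d_{n-1},a}$ have natural densities, and $$\mathbb D\Bigl(\bigcup_{\substack{a\in\mathbb N\\ a\equiv r\ (\mathrm{mod}\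 d)}}\Delta_{d_1,\dots,d_{n-1},a}\Bigr)=\frac1d\,\mathbb D(\Delta_{d_1,\dots,d_{n-1}}) .$$ (For $n=1$ the list $d_1,\dots,d_{n-1}$ is empty and $\Delta$ of the empty list is $\mathbb Z^{1\times m}$.) -/

import Mathlib

open Filter Topology

namespace HermiteDensity

/-- The integer points of the cube `∏ i, [z i - B, z i + B[`. -/
def cube {ι : Type*} (z : ι → ℤ) (B : ℝ) : Set (ι → ℤ) :=
  {x | ∀ i, (z i : ℝ) - B ≤ (x i : ℝ) ∧ (x i : ℝ) < (z i : ℝ) + B}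

/-- A cube has finitely many integer points, so that counting them with `Set.ncard` is honest. -/
theorem cube_finite {ι : Type*} [Finite ι] (z : ι → ℤ) (B : ℝ) : (cube z B).Finite := by
  refine (Set.Finite.pi' (fun i => Set.finite_Ico ⌈(z i : ℝ) - B⌉ ⌈(z i : ℝ) + B⌉)).subset ?_
  intro x hx i
  exact ⟨Int.ceil_le.2 (hx i).1, Int.lt_ceil.2 (hx i).2⟩

/-- `S ⊆ ℤ^ι` has natural density `δ`: for every centre `z ∈ ℤ^ι` the proportion of points of `S`
in the cube `∏ i, [z i - B, z i + B[` has a limit as `B → ∞`, and that limit is `δ` for all `z`. -/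
def HasNaturalDensity {ι : Type*} [Fintype ι] (S : Set (ι → ℤ)) (δ : ℝ) : Prop :=
  ∀ z : ι → ℤ,
    Tendsto (fun B : ℝ => ((S ∩ cube z B).ncard : ℝ) / (2 * B) ^ Fintype.card ι) atTop (𝓝 δ)

/-- Natural density of a set of `n × m` integer matrices, as a subset of `ℤ^(n × m)`. -/
def HasMatrixDensity {n m : ℕ} (S : Set (Matrix (Fin n) (Fin m) ℤ)) (δ : ℝ) : Prop :=
  HasNaturalDensity {x : Fin n × Fin m → ℤ | Matrix.of (fun i j => x (i, j)) ∈ S} δ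

/-- The matrix `H` is in Hermite normal form: it is upper triangular, its nonzero rows are the first
`r` ones, the first nonzero entry of the row `i < r` is positive and stands in the column `j i`,
where `j` is strictly increasing, and the entries above a pivot are nonnegative and smaller than
the pivot. -/
def IsHNF {n m : ℕ} (H : Matrix (Fin n) (Fin m) ℤ) : Prop :=
  (∀ (i : Fin n) (l : Fin m), (l : ℕ) < (i : ℕ) → H i l = 0) ∧
  ∃ (r : ℕ) (hr : r ≤ n) (j : Fin r → Fin m),
    StrictMono j ∧
    (∀ i : Fin n, r ≤ (i : ℕ) → ∀ l : Fin m, H i l = 0) ∧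
    (∀ i : Fin r, 0 < H (Fin.castLE hr i) (j i) ∧
      ∀ l : Fin m, l < j i → H (Fin.castLE hr i) l = 0) ∧
    (∀ k i : Fin r, k < i →
      0 ≤ H (Fin.castLE hr k) (j i) ∧
        H (Fin.castLE hr k) (j i) < H (Fin.castLE hr i) (j i))

/-- `H` is the Hermite normal form of `A`: it is in Hermite normal form and `A = U H` for some
unimodular matrix `U`. -/
def IsHNFOf {n m : ℕ} (H A : Matrix (Fin n) (Fin m) ℤ) : Prop :=
  IsHNF H ∧ ∃ U : GL (Fin n) ℤ, A = (U : Matrix (Fin n) (Fin n) ℤ) * H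

/-- The set `Δ_{d_1, …, d_k}`, for `k ≤ min n m`, of the `n × m` integer matrices whose Hermite
normal form has a diagonal that begins with `d_1, …, d_k`. -/
def Delta {n m k : ℕ} (hk : k ≤ min n m) (d : Fin k → ℕ) : Set (Matrix (Fin n) (Fin m) ℤ) :=
  {A | ∃ H, IsHNFOf H A ∧ ∀ i : Fin k,
    H (Fin.castLE (hk.trans (min_le_left n m)) i) (Fin.castLE (hk.trans (min_le_right n m)) i)
      = (d i : ℤ)}

theorem le_min_of_range {n m k : ℕ} (h₁ : m < n → k ≤ m) (h₂ : n ≤ m → k < n) :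
    k ≤ min n m := by omega

theorem pred_le_min {n m : ℕ} (h : n ≤ m) : n - 1 ≤ min n m := by omega

theorem pred_add_one_le_min {n m : ℕ} (hn : 0 < n) (h : n ≤ m) : n - 1 + 1 ≤ min n m := by omega

end HermiteDensity

namespace HermiteDensity

/-! ### Counting integer points in cubes -/

/-! The diagonal is built one column at a time. Suppose a unimodular `U` makes the first `k` columns
of `A` upper triangular with nonzero diagonal `d`. Two such `U` differ by a left factor whose first
`k` columns vanish below the diagonal, so the gcd of the entries from index `k` on (counted from 0)
of `U` times the next column does not depend on `U`. This gcd, the content, is the next diagonal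
entry (`mem_delta_succ_iff`). As `U` can be chosen from the first `k` columns alone (`reducer`), the
next column is a free variable.

Fix `e`. Since `U⁻¹` is integral, every residue vector modulo `e` is the image of a vector with
entries in `[0, e)`. Adding such vectors exchanges the `e ^ (n - k)` residue classes of the tail of
the image by bounded injections, so all classes have the same density. Hence `e` divides the content
with relative density `e ^ -(n - k)`, and content zero has density zero. Sieving by finitely many
primes and letting their number grow gives relative density `a ^ -(n - k) * ∏ (1 - p ^ -(n - k))`,
that is `1 / (a ^ (n - k) * ζ (n - k))`, for content `a ≠ 0` (`hasNaturalDensity_content_eq`).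

The passage to the limit needs a bound for contents with a prime factor `p > M`, uniform in the cube
size `B` (`eventually_count_prime_le`). For `p ≤ B` the shifts give a bound by `∑ p ^ -2`. For `p >
B` they are too long, and two independent divisibilities are used (`exists_count_large_prime_le`): a
small vector `ℓ` orthogonal to the earlier columns forces `p` to divide an integer of polynomial
size in `B`, so few `p` occur, and each then leaves at most three values for one coordinate.

When `k + 1 = n` the content is the absolute value of one linear form. It is equidistributed modulo
`q` by shifts that preserve the sign of the form, away from a thin slab of density zero
(`hasNaturalDensity_content_modEq`). -/

/-- The number of points of `S` in a cube. -/
noncomputable def count {ι : Type*} (S : Set (ι → ℤ)) (z : ι → ℤ) (B : ℝ) : ℝ :=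
  ((S ∩ cube z B).ncard : ℝ)

/-- The number of integers in `[-B, B)`. -/
noncomputable def side (B : ℝ) : ℕ := (⌈B⌉ - ⌈-B⌉).toNat

theorem side_le {B : ℝ} (hB : 0 ≤ B) : (side B : ℝ) ≤ 2 * B + 1 := by
  have h1 : (0 : ℤ) ≤ ⌈B⌉ - ⌈-B⌉ := by
    have : ⌈-B⌉ ≤ ⌈B⌉ := Int.ceil_mono (by linarith)
    omega
  have h2 : ((side B : ℕ) : ℝ) = (⌈B⌉ : ℝ) - ⌈-B⌉ := by
    unfold side
    rw [← Int.cast_natCast, Int.toNat_of_nonneg h1]; push_cast; ring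
  rw [h2]
  have := Int.ceil_lt_add_one B
  have := Int.le_ceil (-B)
  linarith

theorem le_side {B : ℝ} : 2 * B - 1 ≤ (side B : ℝ) := by
  have h2 : (⌈B⌉ : ℝ) - ⌈-B⌉ ≤ ((side B : ℕ) : ℝ) := by
    unfold side
    rw [← Int.cast_natCast]
    exact_mod_cast Int.self_le_toNat _
  have := Int.le_ceil B
  have := Int.ceil_lt_add_one (-B)
  linarith

theorem count_nonneg {ι : Type*} (S : Set (ι → ℤ)) (z : ι → ℤ) (B : ℝ) : 0 ≤ count S z B := Nat.cast_nonneg _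

theorem count_union_le {ι : Type*} (S T : Set (ι → ℤ)) (z : ι → ℤ) (B : ℝ) :
    count (S ∪ T) z B ≤ count S z B + count T z B := by
  unfold count
  rw [Set.union_inter_distrib_right]
  exact_mod_cast Set.ncard_union_le _ _

section
variable {ι : Type*} [Fintype ι]

theorem ncard_cube (z : ι → ℤ) (B : ℝ) : (cube z B).ncard = side B ^ Fintype.card ι := by
  classical
  have h : cube z B = ((Fintype.piFinset fun i => Finset.Ico ⌈(z i : ℝ) - B⌉ ⌈(z i : ℝ) + B⌉ :
      Finset (ι → ℤ)) : Set (ι → ℤ)) := by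
    ext x
    simp only [cube, Set.mem_ofPred_eq, Fintype.coe_piFinset, Finset.coe_Ico, Set.mem_pi,
      Set.mem_univ, true_implies, Set.mem_Ico, Int.ceil_le, Int.lt_ceil]
  rw [h, Set.ncard_coe_finset, Fintype.card_piFinset]
  have : ∀ i, (Finset.Ico ⌈(z i : ℝ) - B⌉ ⌈(z i : ℝ) + B⌉).card = side B := by
    intro i
    rw [Int.card_Ico, sub_eq_add_neg (z i : ℝ) B, Int.ceil_intCast_add, Int.ceil_intCast_add, side]
    congr 1; ring
  rw [Finset.prod_congr rfl fun i _ => this i, Finset.prod_const, Finset.card_univ]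

theorem count_mono {S T : Set (ι → ℤ)} {z : ι → ℤ} {B : ℝ} (h : S ∩ cube z B ⊆ T) :
    count S z B ≤ count T z B := by
  unfold count
  exact_mod_cast Set.ncard_le_ncard (t := T ∩ cube z B) (fun x hx => ⟨h hx, hx.2⟩)
    ((cube_finite z B).subset Set.inter_subset_right)

theorem count_iUnion_le {ι κ : Type*} (s : Finset κ) (S : κ → Set (ι → ℤ)) (z : ι → ℤ) (B : ℝ) :
    count (⋃ i ∈ s, S i) z B ≤ ∑ i ∈ s, count (S i) z B := by
  classical
  induction s using Finset.induction_on with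
  | empty => simp [count]
  | insert a s ha ih =>
    rw [Finset.set_biUnion_insert, Finset.sum_insert ha]
    exact (count_union_le _ _ _ _).trans (by gcongr)

theorem count_sdiff {S T : Set (ι → ℤ)} (h : T ⊆ S) (z : ι → ℤ) (B : ℝ) :
    count (S \ T) z B = count S z B - count T z B := by
  unfold count
  have hf : (S ∩ cube z B).Finite := (cube_finite z B).subset Set.inter_subset_right
  have := Set.ncard_sdiff_add_ncard_of_subset (s := T ∩ cube z B) (t := S ∩ cube z B)
    (fun x hx => ⟨h hx.1, hx.2⟩) hf
  have e : (S \ T) ∩ cube z B = (S ∩ cube z B) \ (T ∩ cube z B) := by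
    ext x; simp only [Set.mem_inter_iff, Set.mem_sdiff]; tauto
  rw [e, eq_sub_iff_add_eq]
  exact_mod_cast this

theorem count_iUnion {κ : Type*} [Fintype κ] (F : κ → Set (ι → ℤ))
    (hF : Pairwise (Function.onFun Disjoint F)) (z : ι → ℤ) (B : ℝ) :
    count (⋃ g, F g) z B = ∑ g, count (F g) z B := by
  classical
  have key : ∀ s : Finset κ, count (⋃ g ∈ s, F g) z B = ∑ g ∈ s, count (F g) z B := by
    intro s
    induction s using Finset.induction_on with
    | empty => simp [count]
    | insert a s ha ih =>
      have h := count_sdiff (S := ⋃ g ∈ insert a s, F g) (T := F a)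
        (by rw [Finset.set_biUnion_insert]; exact Set.subset_union_left) z B
      rw [Finset.sum_insert ha, ← ih]
      have : (⋃ g ∈ insert a s, F g) \ F a = ⋃ g ∈ s, F g := by
        rw [Finset.set_biUnion_insert, Set.union_sdiff_left, sdiff_eq_left]
        rw [Set.disjoint_iUnion₂_left]
        exact fun g hg => hF (fun h => ha (h ▸ hg))
      rw [this] at h
      linarith
  simpa using key Finset.univ

theorem count_univ (z : ι → ℤ) (B : ℝ) : count Set.univ z B = (side B : ℝ) ^ Fintype.card ι := by
  rw [count, Set.univ_inter, ncard_cube]; push_cast; rfl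

theorem count_le {S : Set (ι → ℤ)} {z : ι → ℤ} {B : ℝ} (hB : 0 ≤ B) :
    count S z B ≤ (2 * B + 1) ^ Fintype.card ι := by
  refine (count_mono (Set.subset_univ _)).trans ?_
  rw [count_univ]
  exact pow_le_pow_left₀ (Nat.cast_nonneg _) (side_le hB) _

/-- An injection that moves each coordinate by at most `e` maps a cube to a slightly larger one. -/
theorem count_le_count_of_injOn {S T : Set (ι → ℤ)} {e : ℕ} {τ : (ι → ℤ) → ι → ℤ}
    (hτ : Set.MapsTo τ S T) (hi : Set.InjOn τ S) (he : ∀ x i, |τ x i - x i| ≤ e)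
    (z : ι → ℤ) (B : ℝ) : count S z B ≤ count T z (B + e) := by
  unfold count
  refine Nat.cast_le.2 (Set.ncard_le_ncard_of_injOn τ ?_ (hi.mono Set.inter_subset_left)
    ((cube_finite z (B + e)).subset Set.inter_subset_right))
  intro x hx
  refine ⟨hτ hx.1, fun i => ?_⟩
  have h := he x i
  have h' : |(τ x i : ℝ) - x i| ≤ e := by exact_mod_cast h
  rw [abs_le] at h'
  have := hx.2 i
  constructor <;> linarith

/-- Counting by fibres of the map that forgets the coordinate `i`. -/
theorem count_le_of_fibre [DecidableEq ι] {X : Set (ι → ℤ)} (i : ι) {C : ℕ} {z : ι → ℤ} {B : ℝ}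
    (hB : 0 ≤ B)
    (h : ∀ x ∈ X ∩ cube z B, {t : ℤ | Function.update x i t ∈ X ∩ cube z B}.ncard ≤ C) :
    count X z B ≤ C * (2 * B + 1) ^ (Fintype.card ι - 1) := by
  classical
  have hfin : (X ∩ cube z B).Finite := (cube_finite z B).subset Set.inter_subset_right
  set s := hfin.toFinset with hs
  let f : (ι → ℤ) → {k // k ≠ i} → ℤ := fun x k => x k
  have h1 : s.card ≤ C * (s.image f).card := by
    refine Finset.card_le_mul_card_image s C ?_
    intro b hb
    obtain ⟨x, hx, rfl⟩ := Finset.mem_image.1 hb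
    have hx' : x ∈ X ∩ cube z B := by simpa [hs] using hx
    refine le_trans ?_ (h x hx')
    rw [← Set.ncard_coe_finset]
    have hup : ∀ y, f y = f x → Function.update x i (y i) = y := by
      intro y hy
      ext k
      by_cases hk : k = i
      · subst hk; simp
      · rw [Function.update_of_ne hk]
        exact (congrFun hy ⟨k, hk⟩).symm
    refine Set.ncard_le_ncard_of_injOn (fun y => y i) ?_ ?_ ?_
    · intro y hy
      have hy' : y ∈ s ∧ f y = f x := by simpa using hy
      have : y ∈ X ∩ cube z B := by simpa [hs] using hy'.1
      simpa [hup y hy'.2] using this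
    · intro y hy y' hy' hyy
      have hy : y ∈ s ∧ f y = f x := by simpa using hy
      have hy' : y' ∈ s ∧ f y' = f x := by simpa using hy'
      rw [← hup y hy.2, ← hup y' hy'.2]
      simp only at hyy
      rw [hyy]
    · refine (Set.finite_Ico ⌈(z i : ℝ) - B⌉ ⌈(z i : ℝ) + B⌉).subset ?_
      intro t ht
      have := ht.2 i
      simp only [Function.update_self] at this
      exact ⟨Int.ceil_le.2 this.1, Int.lt_ceil.2 this.2⟩
  have h2 : (s.image f).card ≤ side B ^ (Fintype.card ι - 1) := by
    have hc : Fintype.card {k // k ≠ i} = Fintype.card ι - 1 := by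
      simp
    rw [← hc, ← ncard_cube (fun k : {k // k ≠ i} => z k) B, ← Set.ncard_coe_finset]
    refine Set.ncard_le_ncard ?_ (cube_finite _ _)
    intro y hy
    obtain ⟨x, hx, rfl⟩ := Finset.mem_image.1 hy
    have hx' : x ∈ X ∩ cube z B := by simpa [hs] using hx
    exact fun k => hx'.2 k
  unfold count
  rw [Set.ncard_eq_toFinset_card _ hfin]
  calc ((s.card : ℕ) : ℝ) ≤ ((C * side B ^ (Fintype.card ι - 1) : ℕ) : ℝ) := by
        exact_mod_cast h1.trans (Nat.mul_le_mul_left _ h2)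
    _ ≤ _ := by
        push_cast
        gcongr
        exact side_le hB

/-! ### Generalities on natural density -/

/-- Since `((B + c) / B) ^ N` tends to 1, enlarging or shrinking the cubes by a bounded amount does
not affect a density. -/
theorem tendsto_div_two_mul {N : ℕ} {f : ℝ → ℝ} {a : ℝ} (c : ℝ)
    (h : Tendsto (fun B => f B / (2 * B) ^ N) atTop (𝓝 a)) :
    Tendsto (fun B => f (B + c) / (2 * B) ^ N) atTop (𝓝 a) := by
  have h1 : Tendsto (fun B : ℝ => f (B + c) / (2 * (B + c)) ^ N) atTop (𝓝 a) :=
    h.comp (tendsto_atTop_add_const_right _ c tendsto_id)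
  have h2 : Tendsto (fun B : ℝ => ((B + c) / B) ^ N) atTop (𝓝 1) := by
    have : Tendsto (fun B : ℝ => 1 + c / B) atTop (𝓝 (1 + 0)) :=
      tendsto_const_nhds.add (tendsto_const_nhds.div_atTop tendsto_id)
    have := this.pow N
    simp only [add_zero, one_pow] at this
    refine this.congr' ?_
    filter_upwards [eventually_gt_atTop 0] with B hB
    congr 1
    field_simp
  have h3 := h1.mul h2
  rw [mul_one] at h3
  refine h3.congr' ?_
  filter_upwards [eventually_gt_atTop 0, eventually_gt_atTop (-c)] with B hB hB'
  have : B + c ≠ 0 := by linarith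
  rw [div_pow, mul_pow, mul_pow]
  field_simp

theorem HasNaturalDensity.count_add {S : Set (ι → ℤ)} {δ : ℝ} (h : HasNaturalDensity S δ)
    (z : ι → ℤ) (c : ℝ) :
    Tendsto (fun B : ℝ => count S z (B + c) / (2 * B) ^ Fintype.card ι) atTop (𝓝 δ) :=
  tendsto_div_two_mul c (h z)

theorem hasNaturalDensity_univ : HasNaturalDensity (Set.univ : Set (ι → ℤ)) 1 := by
  intro z
  change Tendsto (fun B => count Set.univ z B / _) _ _
  simp only [count_univ, ← div_pow]
  have : Tendsto (fun B : ℝ => (side B : ℝ) / (2 * B)) atTop (𝓝 1) := by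
    have h0 : Tendsto (fun B : ℝ => 1 / (2 * B)) atTop (𝓝 0) :=
      tendsto_const_nhds.div_atTop (tendsto_id.const_mul_atTop two_pos)
    have hl : Tendsto (fun B : ℝ => 1 - 1 / (2 * B)) atTop (𝓝 1) := by
      simpa using tendsto_const_nhds.sub h0
    have hu : Tendsto (fun B : ℝ => 1 + 1 / (2 * B)) atTop (𝓝 1) := by
      simpa using tendsto_const_nhds.add h0
    refine tendsto_of_tendsto_of_tendsto_of_le_of_le' hl hu ?_ ?_
    · filter_upwards [eventually_gt_atTop 0] with B hB
      rw [le_div_iff₀ (by positivity)]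
      have := le_side (B := B)
      have e : (1 - 1 / (2 * B)) * (2 * B) = 2 * B - 1 := by field_simp
      linarith
    · filter_upwards [eventually_gt_atTop 0] with B hB
      rw [div_le_iff₀ (by positivity)]
      have := side_le hB.le
      have e : (1 + 1 / (2 * B)) * (2 * B) = 2 * B + 1 := by field_simp
      linarith
  simpa using this.pow (Fintype.card ι)

theorem HasNaturalDensity.sdiff {S T : Set (ι → ℤ)} {δ ε : ℝ} (hS : HasNaturalDensity S δ)
    (hT : HasNaturalDensity T ε) (h : T ⊆ S) : HasNaturalDensity (S \ T) (δ - ε) := by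
  intro z
  refine ((hS z).sub (hT z)).congr fun B => ?_
  change count S z B / _ - count T z B / _ = count (S \ T) z B / _
  rw [count_sdiff h, sub_div]

theorem hasNaturalDensity_zero_of_le {S : Set (ι → ℤ)}
    (h : ∀ ε > 0, ∀ z, ∀ᶠ B in atTop, count S z B / (2 * B) ^ Fintype.card ι ≤ ε) :
    HasNaturalDensity S 0 := by
  intro z
  rw [Metric.tendsto_atTop']
  intro ε hε
  have := (h (ε / 2) (by positivity) z).and (eventually_ge_atTop 0)
  obtain ⟨B₀, hB₀⟩ := eventually_atTop.1 this
  refine ⟨B₀, fun B hB => ?_⟩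
  obtain ⟨h1, h2⟩ := hB₀ B hB.le
  have h3 : 0 ≤ count S z B / (2 * B) ^ Fintype.card ι :=
    div_nonneg (count_nonneg _ _ _) (by positivity)
  change dist (count S z B / _) 0 < ε
  rw [Real.dist_eq, sub_zero, abs_of_nonneg h3]
  linarith

theorem HasNaturalDensity.eventually_le {S : Set (ι → ℤ)} {δ ε : ℝ} (h : HasNaturalDensity S δ)
    (hε : δ < ε) (z : ι → ℤ) : ∀ᶠ B in atTop, count S z B / (2 * B) ^ Fintype.card ι ≤ ε :=
  ((h z).eventually (gt_mem_nhds hε)).mono fun _ h => le_of_lt h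

theorem HasNaturalDensity.mono_zero {S T : Set (ι → ℤ)} (hT : HasNaturalDensity T 0)
    (h : S ⊆ T) : HasNaturalDensity S 0 := by
  refine hasNaturalDensity_zero_of_le fun ε hε z => ?_
  filter_upwards [hT.eventually_le hε z, eventually_ge_atTop 0] with B hB hB0
  refine le_trans ?_ hB
  gcongr
  exact count_mono fun x hx => h hx.1

theorem hasNaturalDensity_biUnion_zero {κ : Type*} (s : Finset κ) {F : κ → Set (ι → ℤ)}
    (h : ∀ g ∈ s, HasNaturalDensity (F g) 0) : HasNaturalDensity (⋃ g ∈ s, F g) 0 := by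
  intro z
  have h1 := tendsto_finsetSum s fun g hg => h g hg z
  rw [Finset.sum_const_zero] at h1
  refine squeeze_zero' ?_ ?_ h1
  · filter_upwards [eventually_ge_atTop 0] with B hB
    positivity
  · filter_upwards [eventually_ge_atTop 0] with B hB
    rw [← Finset.sum_div]
    exact div_le_div_of_nonneg_right (count_iUnion_le s F z B) (by positivity)

/-- A set squeezed, up to small errors, by sets with densities converging to `δ`. -/
theorem hasNaturalDensity_of_approx {S : Set (ι → ℤ)} {T : ℕ → Set (ι → ℤ)} {t ε : ℕ → ℝ} {δ : ℝ}
    (hT : ∀ M, HasNaturalDensity (T M) (t M)) (hST : ∀ M, S ⊆ T M)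
    (ht : Tendsto t atTop (𝓝 δ)) (hε : Tendsto ε atTop (𝓝 0))
    (hE : ∀ M z, ∀ᶠ B in atTop, count (T M \ S) z B / (2 * B) ^ Fintype.card ι ≤ ε M) :
    HasNaturalDensity S δ := by
  intro z
  rw [Metric.tendsto_nhds]
  intro η hη
  have e1 := (Metric.tendsto_nhds.1 ht) (η / 3) (by positivity)
  have e2 := hε.eventually (gt_mem_nhds (show (0 : ℝ) < η / 3 by positivity))
  obtain ⟨M, hM1, hM2⟩ := (e1.and e2).exists
  filter_upwards [(Metric.tendsto_nhds.1 (hT M z)) (η / 3) (by positivity), hE M z,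
    eventually_ge_atTop 0] with B h1 h2 h3
  change dist (count (T M) z B / _) _ < _ at h1
  change dist (count S z B / _) _ < _
  rw [count_sdiff (hST M), sub_div] at h2
  have h4 : count S z B / (2 * B) ^ Fintype.card ι ≤ count (T M) z B / (2 * B) ^ Fintype.card ι := by
    gcongr
    exact count_mono fun x hx => hST M hx.1
  rw [Real.dist_eq, abs_lt] at *
  constructor <;> linarith [h1.1, h1.2, hM1.1, hM1.2]

/-- A non-asymptotic form of equidistribution, valid for every `B`. It is needed where the
displacement `e` may be as large as `B`, so that no limit in `B` can be taken first. -/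
theorem card_mul_count_le {κ : Type*} [Fintype κ] {S : Set (ι → ℤ)} {F : κ → Set (ι → ℤ)}
    (hFS : ∀ g, F g ⊆ S) (hF : Pairwise (Function.onFun Disjoint F)) {e : ℕ} {F₀ : Set (ι → ℤ)}
    (hτ : ∀ h, ∃ τ : (ι → ℤ) → ι → ℤ, Set.MapsTo τ F₀ (F h) ∧ Set.InjOn τ F₀ ∧
      ∀ x i, |τ x i - x i| ≤ e) (z : ι → ℤ) (B : ℝ) :
    Fintype.card κ * count F₀ z B ≤ count S z (B + e) := by
  have h1 : ∀ h, count F₀ z B ≤ count (F h) z (B + e) := fun h => by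
    obtain ⟨τ, h1, h2, h3⟩ := hτ h
    exact count_le_count_of_injOn h1 h2 h3 z B
  have h2 := Finset.sum_le_sum fun h (_ : h ∈ Finset.univ) => h1 h
  rw [← count_iUnion F hF, Finset.sum_const, nsmul_eq_mul, Finset.card_univ] at h2
  exact h2.trans (count_mono fun x hx => (Set.iUnion_subset hFS) hx.1)

/-- The classes of a finite partition that are exchanged by bounded injections, up to a set of
density zero, have the same density. -/
theorem HasNaturalDensity.equidistributed {κ : Type*} [Fintype κ] {S : Set (ι → ℤ)} {δ : ℝ}
    (hS : HasNaturalDensity S δ) {F : κ → Set (ι → ℤ)} (hSF : S = ⋃ g, F g)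
    (hF : Pairwise (Function.onFun Disjoint F)) {Z : Set (ι → ℤ)} (hZ : HasNaturalDensity Z 0)
    {e : ℕ} (hτ : ∀ g h, ∃ τ : (ι → ℤ) → ι → ℤ, Set.MapsTo τ (F g \ Z) (F h) ∧
      Set.InjOn τ (F g \ Z) ∧ ∀ x i, |τ x i - x i| ≤ e) (g : κ) :
    HasNaturalDensity (F g) (δ / Fintype.card κ) := by
  have hκ : (0 : ℝ) < Fintype.card κ := by exact_mod_cast Fintype.card_pos_iff.2 ⟨g⟩
  have h1 : ∀ g h z B, count (F g) z B ≤ count (F h) z (B + e) + count Z z B := by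
    intro g h z B
    obtain ⟨τ, t1, t2, t3⟩ := hτ g h
    have := count_le_count_of_injOn t1 t2 t3 z B
    refine le_trans (le_trans (count_mono ?_) (count_union_le (F g \ Z) Z z B)) (by gcongr)
    intro x hx
    by_cases hxZ : x ∈ Z
    · exact Or.inr hxZ
    · exact Or.inl ⟨hx.1, hxZ⟩
  have hsum : ∀ z B, ∑ g, count (F g) z B = count S z B := by
    intro z B; rw [hSF, count_iUnion F hF]
  intro z
  have up : ∀ B, count (F g) z B ≤
      (count S z (B + e) + Fintype.card κ * count Z z B) / Fintype.card κ := by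
    intro B
    have h2 := Finset.sum_le_sum fun h (_ : h ∈ Finset.univ) => h1 g h z B
    rw [Finset.sum_add_distrib, hsum, Finset.sum_const, Finset.sum_const, nsmul_eq_mul,
      nsmul_eq_mul, Finset.card_univ] at h2
    rw [le_div_iff₀ hκ]; linarith
  -- The injections go from the other classes into `F g`; starting from the cube shrunk by `e` makes
  -- them land in the cube of size `B`.
  have lo : ∀ B, (count S z (B + -e) - Fintype.card κ * count Z z (B + -e)) / Fintype.card κ ≤
      count (F g) z B := by
    intro B
    have h2 := Finset.sum_le_sum fun h (_ : h ∈ Finset.univ) => h1 h g z (B + -e)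
    rw [Finset.sum_add_distrib, hsum, Finset.sum_const, Finset.sum_const, nsmul_eq_mul,
      nsmul_eq_mul, Finset.card_univ, neg_add_cancel_right] at h2
    rw [div_le_iff₀ hκ]; linarith
  have t1 := (((hS.count_add z e).add ((hZ z).const_mul (Fintype.card κ : ℝ)))).div_const
    (Fintype.card κ : ℝ)
  have t2 := (((hS.count_add z (-e)).sub ((hZ.count_add z (-e)).const_mul
    (Fintype.card κ : ℝ)))).div_const (Fintype.card κ : ℝ)
  rw [mul_zero, add_zero] at t1
  rw [mul_zero, sub_zero] at t2
  refine tendsto_of_tendsto_of_tendsto_of_le_of_le' t2 t1 ?_ ?_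
  · filter_upwards [eventually_gt_atTop 0] with B hB
    change _ ≤ count (F g) z B / _
    refine le_trans (le_of_eq ?_) (div_le_div_of_nonneg_right (lo B) (by positivity))
    field_simp
  · filter_upwards [eventually_gt_atTop 0] with B hB
    change count (F g) z B / _ ≤ _
    refine le_trans (div_le_div_of_nonneg_right (up B) (by positivity)) (le_of_eq ?_)
    change _ = (_ + _ * (count Z z B / _)) / _
    field_simp

end

/-! ### Existence of the Hermite normal form -/

open Matrix in
/-- Some unimodular matrix takes an integer vector to a nonnegative multiple of the first unit
vector. -/
theorem exists_gl_mulVec_eq_single {n : ℕ} (c : Fin (n + 1) → ℤ) :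
    ∃ (U : GL (Fin (n + 1)) ℤ) (g : ℤ), 0 ≤ g ∧
      (U : Matrix (Fin (n + 1)) (Fin (n + 1)) ℤ) *ᵥ c = Pi.single 0 g := by
  -- Euclid's algorithm: while two entries are nonzero, adding plus or minus the smaller to the
  -- larger decreases the sum of absolute values.
  induction hN : ∑ i, (c i).natAbs using Nat.strong_induction_on generalizing c with
  | _ N ih =>
  by_cases hc : ∃ a b, a ≠ b ∧ c a ≠ 0 ∧ (c a).natAbs ≤ (c b).natAbs
  · obtain ⟨a, b, hab, ha, hle⟩ := hc
    obtain ⟨s, hs⟩ : ∃ s : ℤ, (c b + s * c a).natAbs < (c b).natAbs := by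
      rcases lt_or_gt_of_ne ha with h | h <;> rcases le_or_gt 0 (c b) with h' | h'
      · exact ⟨1, by omega⟩
      · exact ⟨-1, by omega⟩
      · exact ⟨-1, by omega⟩
      · exact ⟨1, by omega⟩
    let T : GL (Fin (n + 1)) ℤ := GeneralLinearGroup.mk'' (transvection b a s)
      (by rw [det_transvection_of_ne _ _ hab.symm]; exact isUnit_one)
    have hT : (T : Matrix (Fin (n + 1)) (Fin (n + 1)) ℤ) *ᵥ c =
        Function.update c b (c b + s * c a) := by
      simp only [T, GeneralLinearGroup.val_mk'', transvection, add_mulVec, one_mulVec,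
        single_mulVec]
      ext i
      by_cases hi : i = b
      · subst hi; simp
      · simp [hi]
    have hlt : ∑ i, (Function.update c b (c b + s * c a) i).natAbs < N := by
      rw [← hN]
      refine Finset.sum_lt_sum (fun i _ => ?_) ⟨b, Finset.mem_univ _, by simpa using hs⟩
      by_cases hi : i = b
      · subst hi; simpa using hs.le
      · simp [hi]
    obtain ⟨U, g, hg, hU⟩ := ih _ hlt _ rfl
    refine ⟨U * T, g, hg, ?_⟩
    rw [Units.val_mul, ← mulVec_mulVec, hT, hU]
  · push Not at hc
    obtain ⟨a, ha⟩ : ∃ a, ∀ b, b ≠ a → c b = 0 := by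
      by_cases h0 : ∃ a, c a ≠ 0
      · obtain ⟨a, ha⟩ := h0
        refine ⟨a, fun b hb => ?_⟩
        by_contra hb0
        have h1 := hc a b hb.symm ha
        have h2 := hc b a hb hb0
        omega
      · push Not at h0
        exact ⟨0, fun b _ => h0 b⟩
    let P : GL (Fin (n + 1)) ℤ := GeneralLinearGroup.mk'' ((Equiv.swap 0 a).permMatrix ℤ)
      (by rw [det_permutation]; exact (Equiv.Perm.sign _).isUnit.map (Int.castRingHom ℤ))
    have hP : (P : Matrix (Fin (n + 1)) (Fin (n + 1)) ℤ) *ᵥ c = Pi.single 0 (c a) := by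
      simp only [P, GeneralLinearGroup.val_mk'', permMatrix_mulVec]
      ext i
      by_cases hi : i = 0
      · subst hi; simp
      · rw [Function.comp_apply, Pi.single_eq_of_ne hi]
        refine ha _ fun h => hi ?_
        rwa [Equiv.swap_apply_eq_iff, Equiv.swap_apply_right] at h
    rcases le_total 0 (c a) with h | h
    · exact ⟨P, c a, h, hP⟩
    · refine ⟨-P, -c a, by omega, ?_⟩
      rw [Units.val_neg, neg_mulVec, hP, Pi.single_neg]

/-- The conditions of `IsHNF` other than triangularity, which follows from them. -/
theorem isHNF_of_pivots {n m : ℕ} {H : Matrix (Fin n) (Fin m) ℤ} (r : ℕ) (hr : r ≤ n)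
    (j : Fin r → Fin m) (hj : StrictMono j)
    (h0 : ∀ i : Fin n, r ≤ (i : ℕ) → ∀ l : Fin m, H i l = 0)
    (h1 : ∀ i : Fin r, 0 < H (Fin.castLE hr i) (j i) ∧
      ∀ l : Fin m, l < j i → H (Fin.castLE hr i) l = 0)
    (h2 : ∀ k i : Fin r, k < i → 0 ≤ H (Fin.castLE hr k) (j i) ∧
        H (Fin.castLE hr k) (j i) < H (Fin.castLE hr i) (j i)) : IsHNF H := by
  refine ⟨fun i l hl => ?_, r, hr, j, hj, h0, h1, h2⟩
  rcases le_or_gt r i with hi | hi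
  · exact h0 i hi l
  · refine (h1 ⟨i, hi⟩).2 l (Fin.lt_def.2 (lt_of_lt_of_le hl ?_))
    have key : ∀ a : ℕ, ∀ h : a < r, a ≤ (j ⟨a, h⟩ : ℕ) := by
      intro a
      induction a with
      | zero => simp
      | succ a ih =>
        intro h
        have := hj (show (⟨a, by omega⟩ : Fin r) < ⟨a + 1, h⟩ by simp)
        have h3 := ih (by omega)
        have h4 : (j ⟨a, by omega⟩ : ℕ) < j ⟨a + 1, h⟩ := this
        omega
    exact key i hi

open Matrix in
/-- Reduction of a row modulo the pivots of a matrix in Hermite normal form. -/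
theorem exists_reduced_add_vecMul {n m r : ℕ} {H : Matrix (Fin n) (Fin m) ℤ} (hr : r ≤ n)
    {j : Fin r → Fin m} (hj : StrictMono j)
    (h1 : ∀ i : Fin r, 0 < H (Fin.castLE hr i) (j i) ∧
      ∀ l : Fin m, l < j i → H (Fin.castLE hr i) l = 0) (w : Fin m → ℤ) :
    ∃ c : Fin n → ℤ, ∀ i : Fin r, 0 ≤ (w + c ᵥ* H) (j i) ∧
      (w + c ᵥ* H) (j i) < H (Fin.castLE hr i) (j i) := by
  -- Pivots are treated from left to right: a multiple of row `t` vanishes left of its pivot, so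
  -- earlier reductions survive.
  have key : ∀ t : ℕ, t ≤ r → ∃ c : Fin n → ℤ, ∀ i : Fin r, (i : ℕ) < t →
      0 ≤ (w + c ᵥ* H) (j i) ∧ (w + c ᵥ* H) (j i) < H (Fin.castLE hr i) (j i) := by
    intro t
    induction t with
    | zero => exact fun _ => ⟨0, fun i hi => absurd hi (Nat.not_lt_zero _)⟩
    | succ t ih =>
      intro ht
      obtain ⟨c, hc⟩ := ih (by omega)
      let i₀ : Fin r := ⟨t, ht⟩
      let p := H (Fin.castLE hr i₀) (j i₀)
      have hp : 0 < p := (h1 i₀).1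
      refine ⟨c + Pi.single (Fin.castLE hr i₀) (-((w + c ᵥ* H) (j i₀) / p)), fun i hi => ?_⟩
      have e : ∀ l, (w + (c + Pi.single (Fin.castLE hr i₀) (-((w + c ᵥ* H) (j i₀) / p))) ᵥ* H) l =
          (w + c ᵥ* H) l - (w + c ᵥ* H) (j i₀) / p * H (Fin.castLE hr i₀) l := by
        intro l
        rw [add_vecMul, single_vecMul]
        simp only [Pi.add_apply, Pi.smul_apply, row_apply, smul_eq_mul]
        ring
      rw [e]
      rcases Nat.lt_succ_iff_lt_or_eq.1 hi with h | h
      · have hlt : j i < j i₀ := hj h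
        rw [(h1 i₀).2 _ hlt, mul_zero, sub_zero]
        exact hc i h
      · have : i = i₀ := Fin.ext h
        subst this
        change 0 ≤ _ - _ / p * p ∧ _ - _ / p * p < p
        have h3 := Int.emod_nonneg ((w + c ᵥ* H) (j i₀)) hp.ne'
        have h4 := Int.emod_lt_of_pos ((w + c ᵥ* H) (j i₀)) hp
        have h5 := Int.emod_add_ediv_mul ((w + c ᵥ* H) (j i₀)) p
        constructor <;> linarith
  obtain ⟨c, hc⟩ := key r le_rfl
  exact ⟨c, fun i => hc i i.2⟩

-- Induction on the columns. Once the first column is `(g, 0, …, 0)`, either `g = 0` and a zero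
-- column is put before the form of all the rows, or `g > 0` and the form of the remaining block is
-- bordered by a first row reduced modulo its pivots.
open Matrix in
theorem exists_isHNFOf {n m : ℕ} (A : Matrix (Fin n) (Fin m) ℤ) : ∃ H, IsHNFOf H A := by
  induction m generalizing n with
  | zero =>
    exact ⟨A, isHNF_of_pivots 0 (Nat.zero_le _) Fin.elim0 (fun i => i.elim0)
      (fun _ _ l => l.elim0) (fun i => i.elim0) (fun i => i.elim0), 1, by simp⟩
  | succ m ih =>
    cases n with
    | zero =>
      exact ⟨A, isHNF_of_pivots 0 (Nat.zero_le _) Fin.elim0 (fun i => i.elim0)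
        (fun i => i.elim0) (fun i => i.elim0) (fun i => i.elim0), 1, by simp⟩
    | succ n =>
      obtain ⟨V, g, hg, hV⟩ := exists_gl_mulVec_eq_single (fun i => A i 0)
      set A' := (V : Matrix (Fin (n + 1)) (Fin (n + 1)) ℤ) * A with hA'
      have hAA' : A = ((V⁻¹ : GL (Fin (n + 1)) ℤ) : Matrix (Fin (n + 1)) (Fin (n + 1)) ℤ) * A' := by
        rw [hA', ← Matrix.mul_assoc, ← Units.val_mul, inv_mul_cancel, Units.val_one, Matrix.one_mul]
      have hcol : ∀ i, A' i 0 = (Pi.single 0 g : Fin (n + 1) → ℤ) i := fun i => by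
        rw [← hV]; rfl
      suffices h : ∃ H, IsHNFOf H A' by
        obtain ⟨H, hH, U, hU⟩ := h
        refine ⟨H, hH, V⁻¹ * U, ?_⟩
        rw [hAA', hU, Units.val_mul, Matrix.mul_assoc]
      rcases hg.eq_or_lt with rfl | hg
      · obtain ⟨H, ⟨-, r, hr, j, hj, h0, h1, h2⟩, U, hU⟩ := ih (A'.submatrix id Fin.succ)
        refine ⟨of fun i => Fin.cons 0 (H i), isHNF_of_pivots r hr (Fin.succ ∘ j)
          ((Fin.strictMono_succ).comp hj) ?_ ?_ ?_, U, ?_⟩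
        · intro i hi l
          refine Fin.cases ?_ (fun l => ?_) l
          · simp
          · simpa using h0 i hi l
        · intro i
          refine ⟨by simpa using (h1 i).1, fun l => Fin.cases ?_ (fun l => ?_) l⟩
          · simp
          · simpa using (h1 i).2 l
        · intro k i hki
          simpa using h2 k i hki
        · ext i l
          refine Fin.cases ?_ (fun l => ?_) l
          · simp [hcol, Matrix.mul_apply]
          · have := congrFun (congrFun hU i) l
            simpa [Matrix.mul_apply] using this
      · obtain ⟨H, ⟨-, r, hr, j, hj, h0, h1, h2⟩, U, hU⟩ := ih (A'.submatrix Fin.succ Fin.succ)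
        obtain ⟨c, hc⟩ := exists_reduced_add_vecMul hr hj h1 (fun l => A' 0 l.succ)
        set w : Fin m → ℤ := (fun l => A' 0 l.succ) + c ᵥ* H with hw
        -- The block matrix with rows `(1, -c)` and `(0, U)`: the entry `-c` undoes the reduction of
        -- the first row.
        let W : Matrix (Fin (n + 1)) (Fin (n + 1)) ℤ :=
          of (Fin.cons (Fin.cons 1 (-c)) fun i => Fin.cons 0 (U.1 i))
        have hW : IsUnit W.det := by
          have : W.det = U.1.det := by
            rw [det_succ_column_zero, Fin.sum_univ_succ]
            simp [W, submatrix]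
            rfl
          rw [this]
          exact (isUnit_iff_isUnit_det _).1 U.isUnit
        refine ⟨of (Fin.cons (Fin.cons g w) fun i => Fin.cons 0 (H i)),
          isHNF_of_pivots (r + 1) (Nat.succ_le_succ hr) (Fin.cons 0 (Fin.succ ∘ j)) ?_ ?_ ?_ ?_,
          GeneralLinearGroup.mk'' W hW, ?_⟩
        · intro a b
          refine Fin.cases (fun h => ?_) (fun a h => ?_) a
          · refine Fin.cases (fun h => absurd h (lt_irrefl _)) (fun b _ => ?_) b h
            simp
          · refine Fin.cases (fun h => absurd h (by simp)) (fun b h => ?_) b h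
            simpa using hj (by simpa using h)
        · intro i
          refine Fin.cases (fun h => absurd h (by simp)) (fun i h l => ?_) i
          refine Fin.cases (by simp) (fun l => ?_) l
          simpa using h0 i (by simpa using h) l
        · intro i
          refine Fin.cases ⟨by simpa using hg, by simp⟩ (fun i => ?_) i
          have e : Fin.castLE (Nat.succ_le_succ hr) i.succ = (Fin.castLE hr i).succ := rfl
          rw [e]
          refine ⟨by simpa using (h1 i).1, fun l => Fin.cases (by simp) (fun l => ?_) l⟩
          simpa using (h1 i).2 l
        · intro k i
          refine Fin.cases (fun h => absurd h (by simp)) (fun i => ?_) i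
          have e : ∀ i, Fin.castLE (Nat.succ_le_succ hr) (Fin.succ i) = (Fin.castLE hr i).succ :=
            fun _ => rfl
          refine Fin.cases (fun _ => ?_) (fun k h => ?_) k
          · have e0 : Fin.castLE (Nat.succ_le_succ hr) (0 : Fin (r + 1)) = 0 := rfl
            simpa [e, e0] using hc i
          · simpa [e] using h2 k i (by simpa using h)
        · ext i l
          simp only [GeneralLinearGroup.val_mk'', Matrix.mul_apply, Fin.sum_univ_succ]
          refine Fin.cases ?_ (fun i => ?_) i <;> refine Fin.cases ?_ (fun l => ?_) l
          · simp [W, hcol]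
          · simp [W, hw, vecMul, dotProduct]
          · simp [W, hcol]
          · have := congrFun (congrFun hU i) l
            simpa [W, Matrix.mul_apply] using this

/-! ### Triangular reductions of the first columns -/

open Matrix in
/-- An integer matrix that takes a triangular matrix of full rank to a triangular matrix is
triangular in the corresponding columns. -/
theorem eq_zero_of_mul_triangular {n k : ℕ} (hk : k ≤ n) {V : Matrix (Fin n) (Fin n) ℤ}
    {T T' : Matrix (Fin n) (Fin k) ℤ} (h : V * T = T')
    (hT : ∀ l : Fin k, ∀ i : Fin n, (l : ℕ) < i → T i l = 0)
    (hd : ∀ l : Fin k, T (Fin.castLE hk l) l ≠ 0)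
    (hT' : ∀ l : Fin k, ∀ i : Fin n, (l : ℕ) < i → T' i l = 0) :
    ∀ l i : Fin n, (l : ℕ) < k → l < i → V i l = 0 := by
  intro l
  induction l using WellFoundedLT.induction with
  | _ l ih =>
  intro i hl hi
  have h1 := hT' ⟨l, hl⟩ i hi
  rw [← h, mul_apply, Finset.sum_eq_single l] at h1
  · exact (mul_eq_zero.1 h1).resolve_right (hd ⟨l, hl⟩)
  · intro b _ hb
    rcases lt_or_gt_of_ne hb with h2 | h2
    · rw [ih b h2 i (lt_trans h2 hl) (h2.trans hi), zero_mul]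
    · rw [hT _ _ h2, mul_zero]
  · simp

-- In column `l` of `W * V`, on and below the diagonal, only the term `b = l` survives: smaller `b`
-- by induction on the columns of `W`, larger `b` by the shape of `V`.
open Matrix in
theorem diag_mul_diag_eq_one {n k : ℕ} {V W : Matrix (Fin n) (Fin n) ℤ} (h : W * V = 1)
    (hV : ∀ l i : Fin n, (l : ℕ) < k → l < i → V i l = 0) :
    ∀ l : Fin n, (l : ℕ) < k → W l l * V l l = 1 ∧ ∀ i, l < i → W i l = 0 := by
  intro l
  induction l using WellFoundedLT.induction with
  | _ l ih =>
  intro hl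
  have e : ∀ i, l ≤ i → W i l * V l l = (1 : Matrix (Fin n) (Fin n) ℤ) i l := by
    intro i hi
    rw [← h, mul_apply, Finset.sum_eq_single l]
    · intro b _ hb
      rcases lt_or_gt_of_ne hb with h2 | h2
      · rw [(ih b h2 (lt_trans h2 hl)).2 i (h2.trans_le hi), zero_mul]
      · rw [hV _ _ hl h2, mul_zero]
    · simp
  have h1 := e l le_rfl
  rw [one_apply_eq] at h1
  refine ⟨h1, fun i hi => ?_⟩
  have h2 := e i hi.le
  rw [one_apply_ne hi.ne'] at h2
  refine (mul_eq_zero.1 h2).resolve_right fun h3 => ?_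
  rw [h3, mul_zero] at h1
  exact zero_ne_one h1

section
variable {n m k : ℕ}

/-- The first `k` columns of `U * A` are upper triangular with diagonal `d`. -/
def Triangularizes (hk : k ≤ min n m) (d : Fin k → ℕ) (U : GL (Fin n) ℤ)
    (A : Matrix (Fin n) (Fin m) ℤ) : Prop :=
  ∀ (l : Fin k) (i : Fin n), (l : ℕ) ≤ i →
    ((U : Matrix (Fin n) (Fin n) ℤ) * A) i (Fin.castLE (hk.trans (min_le_right n m)) l) =
      if (i : ℕ) = l then (d l : ℤ) else 0

theorem Triangularizes.congr {hk : k ≤ min n m} {d : Fin k → ℕ} {U : GL (Fin n) ℤ}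
    {A A' : Matrix (Fin n) (Fin m) ℤ} (h : Triangularizes hk d U A)
    (hA : ∀ i (l : Fin m), (l : ℕ) < k → A i l = A' i l) : Triangularizes hk d U A' := by
  intro l i hi
  rw [← h l i hi, Matrix.mul_apply, Matrix.mul_apply]
  exact Finset.sum_congr rfl fun b _ => by rw [hA b _ l.2]

theorem IsHNFOf.exists_mul_eq {H A : Matrix (Fin n) (Fin m) ℤ} (h : IsHNFOf H A) :
    ∃ U : GL (Fin n) ℤ, (U : Matrix (Fin n) (Fin n) ℤ) * A = H := by
  obtain ⟨-, U, rfl⟩ := h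
  exact ⟨U⁻¹, by rw [← Matrix.mul_assoc, ← Units.val_mul, inv_mul_cancel, Units.val_one,
    Matrix.one_mul]⟩

theorem exists_triangularizes {hk : k ≤ min n m} {d : Fin k → ℕ} {A : Matrix (Fin n) (Fin m) ℤ}
    (h : A ∈ Delta hk d) : ∃ U, Triangularizes hk d U A := by
  obtain ⟨H, hH, hd⟩ := h
  obtain ⟨U, rfl⟩ := hH.exists_mul_eq
  refine ⟨U, fun l i hi => ?_⟩
  split_ifs with h
  · have hi : i = Fin.castLE (hk.trans (min_le_left n m)) l := Fin.ext h
    rw [← hd l, hi]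
  · exact hH.1.1 _ _ (lt_of_le_of_ne hi (Ne.symm h))

/-- By triangularity a pivot cannot stand left of the diagonal, so a diagonal entry is zero or is
itself a pivot. -/
theorem IsHNF.diag_nonneg {H : Matrix (Fin n) (Fin m) ℤ} (h : IsHNF H) {i : Fin n} {l : Fin m}
    (hil : (i : ℕ) = l) : 0 ≤ H i l := by
  obtain ⟨h0, r, hr, j, -, h1, h2, -⟩ := h
  rcases le_or_gt r i with hi | hi
  · rw [h1 i hi]
  · obtain ⟨h3, h4⟩ := h2 ⟨i, hi⟩
    rcases lt_trichotomy l (j ⟨i, hi⟩) with h | h | h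
    · exact (h4 l h).ge
    · rw [h]; exact h3.le
    · refine absurd (h0 i (j ⟨i, hi⟩) ?_) h3.ne'
      exact lt_of_lt_of_eq h hil.symm

theorem exists_mem_delta (hk : k ≤ min n m) (A : Matrix (Fin n) (Fin m) ℤ) :
    ∃ d, A ∈ Delta hk d := by
  obtain ⟨H, hH⟩ := exists_isHNFOf A
  refine ⟨fun i => (H (Fin.castLE (hk.trans (min_le_left n m)) i)
    (Fin.castLE (hk.trans (min_le_right n m)) i)).toNat, H, hH, fun i => ?_⟩
  exact (Int.toNat_of_nonneg (hH.1.diag_nonneg rfl)).symm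

theorem Triangularizes.eq_zero {hk : k ≤ min n m} {d d' : Fin k → ℕ} {U U' : GL (Fin n) ℤ}
    {A : Matrix (Fin n) (Fin m) ℤ} (h : Triangularizes hk d U A) (hd : ∀ i, d i ≠ 0)
    (h' : Triangularizes hk d' U' A) (l i : Fin n) (hl : (l : ℕ) < k) (hi : l < i) :
    ((U' * U⁻¹ : GL (Fin n) ℤ) : Matrix (Fin n) (Fin n) ℤ) i l = 0 := by
  let c : Fin k → Fin m := Fin.castLE (hk.trans (min_le_right n m))
  have hmul : ((U' * U⁻¹ : GL (Fin n) ℤ) : Matrix (Fin n) (Fin n) ℤ) * (U.1 * A) = U'.1 * A := by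
    rw [← Matrix.mul_assoc, ← Units.val_mul, inv_mul_cancel_right]
  refine eq_zero_of_mul_triangular (hk.trans (min_le_left n m))
    (T := (U.1 * A).submatrix id c) (T' := (U'.1 * A).submatrix id c) ?_ ?_ ?_ ?_ l i hl hi
  · rw [← hmul]; rfl
  · intro l i hl
    exact (h l i hl.le).trans (if_neg hl.ne')
  · intro l
    refine ((h l _ le_rfl).trans (if_pos rfl)).trans_ne ?_
    exact_mod_cast hd l
  · intro l i hl
    exact (h' l i hl.le).trans (if_neg hl.ne')

/-- The transition matrix `U' * U⁻¹` has diagonal entries `±1` in its first `k` columns, so the two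
diagonals agree up to sign, and both are nonnegative. -/
theorem Triangularizes.unique {hk : k ≤ min n m} {d d' : Fin k → ℕ} {U U' : GL (Fin n) ℤ}
    {A : Matrix (Fin n) (Fin m) ℤ} (h : Triangularizes hk d U A) (hd : ∀ i, d i ≠ 0)
    (h' : Triangularizes hk d' U' A) : d = d' := by
  have hV := h.eq_zero hd h'
  set V := U' * U⁻¹ with hVdef
  have hWV : ((V⁻¹ : GL (Fin n) ℤ) : Matrix (Fin n) (Fin n) ℤ) * V.1 = 1 := by
    rw [← Units.val_mul, inv_mul_cancel, Units.val_one]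
  have hmul : V.1 * (U.1 * A) = U'.1 * A := by
    rw [← Matrix.mul_assoc, ← Units.val_mul, hVdef, inv_mul_cancel_right]
  ext l
  let l' : Fin n := Fin.castLE (hk.trans (min_le_left n m)) l
  have h1 := (diag_mul_diag_eq_one hWV (fun l i hl hi => hV l i hl hi) l' l.2).1
  have h2 := h' l l' le_rfl
  rw [if_pos (show (l' : ℕ) = l from rfl), ← hmul, Matrix.mul_apply,
    Finset.sum_eq_single l'] at h2
  · rw [h l l' le_rfl, if_pos (show (l' : ℕ) = l from rfl)] at h2
    have h3 : (V.1 l' l').natAbs = 1 := Int.isUnit_iff_natAbs_eq.1 (IsUnit.of_mul_eq_one_right _ h1)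
    have h4 := congrArg Int.natAbs h2
    rw [Int.natAbs_mul, h3, one_mul] at h4
    simpa using h4
  · intro b _ hb
    rcases lt_or_gt_of_ne hb with h2 | h2
    · rw [hV b l' (lt_trans h2 l.2) h2, zero_mul]
    · have h2' : (l : ℕ) < b := h2
      rw [h l b h2'.le, if_neg h2'.ne', mul_zero]
  · simp

/-- A nonzero diagonal is thus detected by any triangular reduction. Existence of a normal form and
uniqueness of this diagonal suffice; uniqueness of the whole form is not used. -/
theorem Triangularizes.mem_delta {hk : k ≤ min n m} {d : Fin k → ℕ} {U : GL (Fin n) ℤ}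
    {A : Matrix (Fin n) (Fin m) ℤ} (h : Triangularizes hk d U A) (hd : ∀ i, d i ≠ 0) :
    A ∈ Delta hk d := by
  obtain ⟨d', hd'⟩ := exists_mem_delta hk A
  obtain ⟨U', hU'⟩ := exists_triangularizes hd'
  rwa [h.unique hd hU']

theorem delta_init {hk : k + 1 ≤ min n m} {d : Fin (k + 1) → ℕ} {A : Matrix (Fin n) (Fin m) ℤ}
    (h : A ∈ Delta hk d) : A ∈ Delta ((Nat.le_succ k).trans hk) (Fin.init d) := by
  obtain ⟨H, hH, hd⟩ := h
  exact ⟨H, hH, fun i => hd i.castSucc⟩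

theorem Triangularizes.init {hk : k + 1 ≤ min n m} {d : Fin (k + 1) → ℕ} {U : GL (Fin n) ℤ}
    {A : Matrix (Fin n) (Fin m) ℤ} (h : Triangularizes hk d U A) :
    Triangularizes ((Nat.le_succ k).trans hk) (Fin.init d) U A :=
  fun l i hi => h l.castSucc i hi

/-- The lower left block of `U' * U⁻¹` is zero, so the entries from index `k` on of the new column
are integer combinations of those of the old one. -/
theorem Triangularizes.forall_dvd {hk : k ≤ min n m} {d : Fin k → ℕ} {U U' : GL (Fin n) ℤ}
    {A : Matrix (Fin n) (Fin m) ℤ} (h : Triangularizes hk d U A) (hd : ∀ i, d i ≠ 0)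
    (h' : Triangularizes hk d U' A) {j : Fin m} {e : ℤ}
    (he : ∀ i : Fin n, k ≤ (i : ℕ) → e ∣ (U.1 * A) i j) (i : Fin n) (hi : k ≤ (i : ℕ)) :
    e ∣ (U'.1 * A) i j := by
  have hV := h.eq_zero hd h'
  have hmul : (U' * U⁻¹).1 * (U.1 * A) = U'.1 * A := by
    rw [← Matrix.mul_assoc, ← Units.val_mul, inv_mul_cancel_right]
  rw [← hmul, Matrix.mul_apply]
  refine Finset.dvd_sum fun b _ => ?_
  rcases lt_or_ge (b : ℕ) k with hb | hb
  · rw [hV b i hb (Fin.lt_def.2 (lt_of_lt_of_le hb hi)), zero_mul]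
    exact dvd_zero _
  · exact (he b hb).mul_left _

/-- The greatest common divisor of the entries from index `k` on. -/
def tailGcd (k : ℕ) (v : Fin n → ℤ) : ℕ :=
  (Finset.univ.filter fun i : Fin n => k ≤ (i : ℕ)).gcd fun i => (v i).natAbs

theorem dvd_tailGcd {k e : ℕ} {v : Fin n → ℤ} :
    e ∣ tailGcd k v ↔ ∀ i : Fin n, k ≤ (i : ℕ) → (e : ℤ) ∣ v i := by
  simp only [tailGcd, Finset.dvd_gcd_iff, Finset.mem_filter, Finset.mem_univ, true_and,
    Int.natCast_dvd]

/-- Which `a` is the next diagonal entry can be read off from any triangular reduction of the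
previous columns. -/
theorem mem_delta_succ_iff {hk : k + 1 ≤ min n m} {d : Fin k → ℕ} (hd : ∀ i, d i ≠ 0)
    {U : GL (Fin n) ℤ} {A : Matrix (Fin n) (Fin m) ℤ}
    (h : Triangularizes ((Nat.le_succ k).trans hk) d U A) (a : ℕ) :
    A ∈ Delta hk (Fin.snoc (α := fun _ => ℕ) d a) ↔
      tailGcd k (fun i => (U.1 * A) i ⟨k, hk.trans (min_le_right n m)⟩) = a := by
  have key : ∀ a, A ∈ Delta hk (Fin.snoc (α := fun _ => ℕ) d a) →
      tailGcd k (fun i => (U.1 * A) i ⟨k, hk.trans (min_le_right n m)⟩) = a := by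
    intro a ha
    obtain ⟨U', hU'⟩ := exists_triangularizes ha
    have hi := hU'.init
    rw [Fin.init_snoc] at hi
    have hcol : ∀ i : Fin n, k ≤ (i : ℕ) → (U'.1 * A) i ⟨k, hk.trans (min_le_right n m)⟩ =
        if (i : ℕ) = k then (a : ℤ) else 0 := by
      intro i hi
      have := hU' (Fin.last k) i hi
      rwa [Fin.snoc_last] at this
    refine Nat.dvd_left_iff_eq.1 fun e => ?_
    rw [dvd_tailGcd]
    constructor
    · intro he
      have := h.forall_dvd hd hi he ⟨k, hk.trans (min_le_left n m)⟩ le_rfl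
      rw [hcol _ le_rfl, if_pos rfl] at this
      exact_mod_cast this
    · intro he
      refine hi.forall_dvd hd h fun i hi => ?_
      rw [hcol i hi]
      split_ifs
      · exact_mod_cast he
      · exact dvd_zero _
  refine ⟨key a, ?_⟩
  rintro rfl
  obtain ⟨d', hd'⟩ := exists_mem_delta hk A
  obtain ⟨U', hU'⟩ := exists_triangularizes hd'
  have h1 := h.unique hd hU'.init
  have h2 : d' = Fin.snoc (α := fun _ => ℕ) d (d' (Fin.last k)) := by
    rw [h1, Fin.snoc_init_self]
  rw [h2] at hd'
  rwa [key _ hd']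

end

/-! ### Adding one column -/

theorem tendsto_const_mul_pow_pred_div (C : ℝ) {N : ℕ} (hN : N ≠ 0) :
    Tendsto (fun B : ℝ => C * (2 * B + 1) ^ (N - 1) / (2 * B) ^ N) atTop (𝓝 0) := by
  obtain ⟨N, rfl⟩ := Nat.exists_eq_succ_of_ne_zero hN
  have h0 : Tendsto (fun B : ℝ => 1 / (2 * B)) atTop (𝓝 0) :=
    tendsto_const_nhds.div_atTop (tendsto_id.const_mul_atTop two_pos)
  have h1 : Tendsto (fun B : ℝ => 1 + 1 / (2 * B)) atTop (𝓝 1) := by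
    simpa using tendsto_const_nhds.add h0
  have h2 := ((h1.pow N).const_mul C).mul h0
  rw [mul_zero] at h2
  refine h2.congr' ?_
  filter_upwards [eventually_gt_atTop 0] with B hB
  have : 1 + 1 / (2 * B) = (2 * B + 1) / (2 * B) := by field_simp
  rw [this, div_pow, Nat.succ_sub_one, pow_succ]
  field_simp

theorem hasNaturalDensity_zero_of_count_le {ι : Type*} [Fintype ι] [Nonempty ι] {S : Set (ι → ℤ)}
    {C : ℝ} (h : ∀ z, ∀ B, 0 ≤ B → count S z B ≤ C * (2 * B + 1) ^ (Fintype.card ι - 1)) :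
    HasNaturalDensity S 0 := by
  refine hasNaturalDensity_zero_of_le fun ε hε z => ?_
  filter_upwards [(tendsto_const_mul_pow_pred_div C (Fintype.card_ne_zero (α := ι))).eventually
    (gt_mem_nhds hε), eventually_ge_atTop 0] with B h1 h2
  exact (div_le_div_of_nonneg_right (h z B h2) (by positivity)).trans h1.le

theorem ncard_le_of_abs_sub_le {T : Set ℤ} {D : ℕ} (h : ∀ s ∈ T, ∀ t ∈ T, |s - t| ≤ D) :
    T.ncard ≤ 2 * D + 1 := by
  rcases T.eq_empty_or_nonempty with rfl | ⟨t, ht⟩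
  · simp
  · have hsub : T ⊆ (Finset.Icc (t - D) (t + D) : Finset ℤ) := by
      intro s hs
      have := abs_le.1 (h s hs t ht)
      simp only [Finset.coe_Icc, Set.mem_Icc]
      omega
    refine (Set.ncard_le_ncard hsub (Finset.finite_toSet _)).trans ?_
    rw [Set.ncard_coe_finset, Int.card_Icc]
    omega

section
variable {n m : ℕ}

/-- Adding a vector to a column. -/
def shiftCol (j : Fin m) (v : Fin n → ℤ) (x : Fin n × Fin m → ℤ) : Fin n × Fin m → ℤ :=
  fun p => x p + if p.2 = j then v p.1 else 0

theorem shiftCol_apply_self (j : Fin m) (v : Fin n → ℤ) (x : Fin n × Fin m → ℤ) (i : Fin n) :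
    shiftCol j v x (i, j) = x (i, j) + v i := by simp [shiftCol]

theorem shiftCol_apply_of_ne {j l : Fin m} (h : l ≠ j) (v : Fin n → ℤ) (x : Fin n × Fin m → ℤ)
    (i : Fin n) : shiftCol j v x (i, l) = x (i, l) := by simp [shiftCol, h]

theorem shiftCol_injective (j : Fin m) (v : Fin n → ℤ) : Function.Injective (shiftCol j v) := by
  intro x y h
  ext p
  have := congrFun h p
  simpa [shiftCol] using this

theorem update_eq_shiftCol (x : Fin n × Fin m → ℤ) (i : Fin n) (j : Fin m) (t : ℤ) :
    Function.update x (i, j) t = shiftCol j (Pi.single i (t - x (i, j))) x := by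
  ext ⟨a, b⟩
  by_cases hb : b = j
  · subst hb
    rw [shiftCol_apply_self]
    by_cases ha : a = i
    · subst ha; simp
    · simp [ha]
  · rw [shiftCol_apply_of_ne hb, Function.update_of_ne (by simp [hb])]

theorem sum_mul_update (c : Fin n → ℤ) (x : Fin n × Fin m → ℤ) (i : Fin n) (j : Fin m) (t : ℤ) :
    ∑ b, c b * Function.update x (i, j) t (b, j) =
      ∑ b, c b * x (b, j) + c i * (t - x (i, j)) := by
  rw [update_eq_shiftCol]
  simp only [shiftCol_apply_self, mul_add, Finset.sum_add_distrib]
  congr 1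
  rw [Finset.sum_eq_single i] <;> simp +contextual

/-- A neighbourhood of a hyperplane, of width bounded in terms of a coefficient, has density
zero. -/
theorem hasNaturalDensity_slab (j : Fin m) {c : (Fin n × Fin m → ℤ) → Fin n → ℤ}
    (hc : ∀ x v, c (shiftCol j v x) = c x) (K : ℕ) :
    HasNaturalDensity {x : Fin n × Fin m → ℤ | ∃ i, c x i ≠ 0 ∧
      |∑ b, c x b * x (b, j)| ≤ K * |c x i|} 0 := by
  rcases isEmpty_or_nonempty (Fin n) with hn | hn
  · convert (hasNaturalDensity_univ (ι := Fin n × Fin m)).sdiff hasNaturalDensity_univ subset_rfl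
      using 1
    · ext x; simp
    · simp
  have : Nonempty (Fin n × Fin m) := ⟨(Classical.arbitrary _, j)⟩
  let Z : Fin n → Set (Fin n × Fin m → ℤ) := fun i => {x | c x i ≠ 0 ∧
      |∑ b, c x b * x (b, j)| ≤ K * |c x i|}
  have hZ : ∀ i z B, 0 ≤ B →
      count (Z i) z B ≤ (4 * K + 1 : ℕ) * (2 * B + 1) ^ (Fintype.card (Fin n × Fin m) - 1) := by
    intro i z B hB
    -- Changing the coordinate `(i, j)` fixes `c x` and moves the sum with slope `c x i`, so
    -- admissible values are at most `2 * K` apart.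
    refine count_le_of_fibre (i, j) hB fun x hx => ?_
    have h4 : 4 * K + 1 = 2 * (2 * K) + 1 := by ring
    rw [h4]
    refine ncard_le_of_abs_sub_le fun s hs t ht => ?_
    obtain ⟨⟨h1, h2⟩, -⟩ := hs
    obtain ⟨⟨-, h3⟩, -⟩ := ht
    rw [sum_mul_update] at h2 h3
    rw [update_eq_shiftCol, hc] at h1 h2 h3
    have h5 : |c x i * (s - t)| ≤ 2 * K * |c x i| := by
      have e : c x i * (s - t) = (∑ b, c x b * x (b, j) + c x i * (s - x (i, j))) -
        (∑ b, c x b * x (b, j) + c x i * (t - x (i, j))) := by ring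
      rw [e]
      refine (abs_sub _ _).trans ?_
      linarith
    rw [abs_mul, mul_comm] at h5
    push_cast
    exact le_of_mul_le_mul_right h5 (abs_pos.2 h1)
  have h1 : {x : Fin n × Fin m → ℤ | ∃ i, c x i ≠ 0 ∧ |∑ b, c x b * x (b, j)| ≤ K * |c x i|} =
      ⋃ i ∈ (Finset.univ : Finset (Fin n)), Z i := by
    ext x; simp [Z]
  rw [h1]
  exact hasNaturalDensity_biUnion_zero _ fun i _ => hasNaturalDensity_zero_of_count_le (hZ i)

/-- A reduction of the columns before `j`, for the elements of `S`: membership in `S` and the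
reducing matrix do not depend on column `j`, and what is orthogonal to the columns before `j` is
a combination of the rows from index `k` on of the reducing matrix. -/
structure ColumnReduction (S : Set (Fin n × Fin m → ℤ)) (k : ℕ) (j : Fin m) where
  /-- the reducing matrix -/
  R : (Fin n × Fin m → ℤ) → GL (Fin n) ℤ
  shift_mem : ∀ x ∈ S, ∀ v, shiftCol j v x ∈ S
  R_shift : ∀ x v, R (shiftCol j v x) = R x
  vecMul_inv_eq_zero : ∀ x ∈ S, ∀ ℓ : Fin n → ℤ, (∀ l < j, ∑ i, ℓ i * x (i, l) = 0) →
    ∀ i : Fin n, (i : ℕ) < k → Matrix.vecMul ℓ ((R x)⁻¹ : GL (Fin n) ℤ).1 i = 0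

namespace ColumnReduction
variable {S : Set (Fin n × Fin m → ℤ)} {k : ℕ} {j : Fin m} (ρ : ColumnReduction S k j)

/-- The image of column `j` under the reducing matrix. -/
def image (x : Fin n × Fin m → ℤ) (i : Fin n) : ℤ := ∑ b, (ρ.R x).1 i b * x (b, j)

/-- The greatest common divisor of the entries from `k` on of the image of column `j`. -/
def content (x : Fin n × Fin m → ℤ) : ℕ := tailGcd k (ρ.image x)

theorem image_shiftCol (x : Fin n × Fin m → ℤ) (v : Fin n → ℤ) :
    ρ.image (shiftCol j v x) = ρ.image x + Matrix.mulVec (ρ.R x).1 v := by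
  ext i
  simp only [image, ρ.R_shift, shiftCol_apply_self, mul_add, Finset.sum_add_distrib, Pi.add_apply,
    Matrix.mulVec, dotProduct]

/-- A vector with entries in `[0, e)` whose image is congruent to `w` modulo `e`. -/
def lift (e : ℕ) (U : GL (Fin n) ℤ) (w : Fin n → ℤ) (i : Fin n) : ℤ :=
  Matrix.mulVec (U⁻¹ : GL (Fin n) ℤ).1 w i % e

theorem mulVec_lift (e : ℕ) (U : GL (Fin n) ℤ) (w : Fin n → ℤ) (i : Fin n) :
    ((Matrix.mulVec U.1 (lift e U w) i : ℤ) : ZMod e) = w i := by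
  have h : Matrix.mulVec U.1 (Matrix.mulVec (U⁻¹ : GL (Fin n) ℤ).1 w) = w := by
    rw [Matrix.mulVec_mulVec, ← Units.val_mul, mul_inv_cancel, Units.val_one, Matrix.one_mulVec]
  conv_rhs => rw [← h]
  simp only [Matrix.mulVec, dotProduct, Int.cast_sum, Int.cast_mul]
  refine Finset.sum_congr rfl fun b _ => ?_
  congr 1
  rw [lift, ZMod.intCast_mod]
  simp [Matrix.mulVec, dotProduct]

theorem lift_nonneg {e : ℕ} (he : e ≠ 0) (U : GL (Fin n) ℤ) (w : Fin n → ℤ) (i : Fin n) :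
    0 ≤ lift e U w i := Int.emod_nonneg _ (by exact_mod_cast he)

theorem lift_lt {e : ℕ} (he : e ≠ 0) (U : GL (Fin n) ℤ) (w : Fin n → ℤ) (i : Fin n) :
    lift e U w i < e := Int.emod_lt_of_pos _ (by omega)

theorem abs_shiftCol_lift_sub_le {e : ℕ} (he : e ≠ 0) (U : GL (Fin n) ℤ) (w : Fin n → ℤ)
    (x : Fin n × Fin m → ℤ) (p : Fin n × Fin m) : |shiftCol j (lift e U w) x p - x p| ≤ e := by
  simp only [shiftCol, add_sub_cancel_left]
  split_ifs
  · rw [abs_of_nonneg (lift_nonneg he _ _ _)]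
    exact (lift_lt he _ _ _).le
  · simp

/-- The elements of `S` with prescribed residues. -/
def residueClass (e : ℕ) (g : {i : Fin n // k ≤ (i : ℕ)} → ZMod e) : Set (Fin n × Fin m → ℤ) :=
  {x | x ∈ S ∧ ∀ i : {i : Fin n // k ≤ (i : ℕ)}, (ρ.image x i : ZMod e) = g i}

theorem residueClass_disjoint (e : ℕ) :
    Pairwise (Function.onFun Disjoint (ρ.residueClass e)) := by
  intro g h hgh
  refine Set.disjoint_left.2 fun x hx hx' => hgh ?_
  ext i
  rw [← hx.2 i, ← hx'.2 i]

/-- The shift lifts `h - g` through the inverse of `R x`. Since shifting does not change `R x`, the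
vector added can be recovered from the shifted point, whence injectivity. -/
theorem exists_shift (e : ℕ) [NeZero e] (g h : {i : Fin n // k ≤ (i : ℕ)} → ZMod e) :
    ∃ τ : (Fin n × Fin m → ℤ) → Fin n × Fin m → ℤ,
      Set.MapsTo τ (ρ.residueClass e g) (ρ.residueClass e h) ∧
      Set.InjOn τ (ρ.residueClass e g) ∧ ∀ x i, |τ x i - x i| ≤ e := by
  let w : Fin n → ℤ := fun i => if hi : k ≤ (i : ℕ) then ((h - g) ⟨i, hi⟩).val else 0
  refine ⟨fun x => shiftCol j (lift e (ρ.R x) w) x, ?_, ?_, fun x i => ?_⟩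
  · rintro x ⟨hx, hg⟩
    refine ⟨ρ.shift_mem x hx _, fun i => ?_⟩
    rw [image_shiftCol, Pi.add_apply, Int.cast_add, mulVec_lift, hg]
    simp [w, i.2]
  · intro x _ y _ hxy
    have hR := congrArg ρ.R hxy
    simp only [ρ.R_shift] at hR
    simp only [hR] at hxy
    exact shiftCol_injective _ _ hxy
  · exact abs_shiftCol_lift_sub_le (NeZero.ne e) _ _ _ _

theorem residueClass_zero (e : ℕ) : ρ.residueClass e 0 = {x | x ∈ S ∧ e ∣ ρ.content x} := by
  ext x
  simp only [residueClass, content, dvd_tailGcd, Set.mem_ofPred_eq, Pi.zero_apply,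
    ZMod.intCast_zmod_eq_zero_iff_dvd, Subtype.forall]

theorem card_tail (hk : k < n) : Fintype.card {i : Fin n // k ≤ (i : ℕ)} = n - k := by
  have := Fin.card_Ici (⟨k, hk⟩ : Fin n)
  rw [← this, Fintype.card_subtype]
  congr 1
  ext i
  simp [Fin.le_def]

theorem hasNaturalDensity_dvd {δ : ℝ} (hS : HasNaturalDensity S δ) (hk : k < n) {e : ℕ}
    (he : e ≠ 0) :
    HasNaturalDensity {x | x ∈ S ∧ e ∣ ρ.content x} (δ / (e : ℝ) ^ (n - k)) := by
  have : NeZero e := ⟨he⟩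
  rw [← ρ.residueClass_zero]
  have h0 : HasNaturalDensity (∅ : Set (Fin n × Fin m → ℤ)) 0 := by
    simpa using hS.sdiff hS subset_rfl
  have := hS.equidistributed (F := ρ.residueClass e) ?_ (ρ.residueClass_disjoint e) h0 (e := e)
    (fun g h => by simpa using ρ.exists_shift e g h) 0
  · convert this using 2
    rw [Fintype.card_fun, ZMod.card, card_tail hk, Nat.cast_pow]
  · ext x
    simp only [residueClass, Set.mem_iUnion, Set.mem_ofPred_eq]
    exact ⟨fun h => ⟨_, h, fun i => rfl⟩, fun ⟨_, h, _⟩ => h⟩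

theorem count_dvd_le (hk : k < n) {e : ℕ} (he : e ≠ 0) (z : Fin n × Fin m → ℤ) (B : ℝ) :
    (e : ℝ) ^ (n - k) * count {x | x ∈ S ∧ e ∣ ρ.content x} z B ≤ count S z (B + e) := by
  have : NeZero e := ⟨he⟩
  rw [← ρ.residueClass_zero]
  have := card_mul_count_le (S := S) (F := ρ.residueClass e) (fun g x hx => hx.1)
    (ρ.residueClass_disjoint e) (e := e) (F₀ := ρ.residueClass e 0) (ρ.exists_shift e 0) z B
  rwa [Fintype.card_fun, ZMod.card, card_tail hk, Nat.cast_pow] at this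

/-- Zero is divisible by every `e`, and the density of divisibility by `e` tends to 0. -/
theorem hasNaturalDensity_content_eq_zero {δ : ℝ} (hS : HasNaturalDensity S δ) (hk : k < n) :
    HasNaturalDensity {x | x ∈ S ∧ ρ.content x = 0} 0 := by
  refine hasNaturalDensity_zero_of_le fun ε hε z => ?_
  have h1 : Tendsto (fun e : ℕ => δ / (e : ℝ) ^ (n - k)) atTop (𝓝 0) :=
    tendsto_const_nhds.div_atTop
      ((tendsto_pow_atTop (by omega)).comp tendsto_natCast_atTop_atTop)
  obtain ⟨e, he, he0⟩ := ((h1.eventually (gt_mem_nhds hε)).and (eventually_ne_atTop 0)).exists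
  filter_upwards [(ρ.hasNaturalDensity_dvd hS hk he0).eventually_le he z, eventually_ge_atTop 0]
    with B h2 h3
  refine le_trans ?_ h2
  gcongr
  exact count_mono fun x hx => ⟨hx.1.1, by rw [hx.1.2]; exact dvd_zero _⟩

/-- Inclusion–exclusion, one prime at a time: imposing the condition at a new prime `q` subtracts
the same set with `q * e` in place of `e`, hence the induction for all `e`. -/
theorem hasNaturalDensity_dvd_not_dvd {δ : ℝ} (hS : HasNaturalDensity S δ) (hk : k < n)
    (P : Finset ℕ) (hP : ∀ p ∈ P, p.Prime) {e : ℕ} (he : e ≠ 0) :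
    HasNaturalDensity {x | x ∈ S ∧ e ∣ ρ.content x ∧ ∀ p ∈ P, ¬ p * e ∣ ρ.content x}
      (δ / (e : ℝ) ^ (n - k) * ∏ p ∈ P, (1 - ((p : ℝ) ^ (n - k))⁻¹)) := by
  induction P using Finset.induction_on generalizing e with
  | empty => simpa using ρ.hasNaturalDensity_dvd hS hk he
  | insert q P hq ih =>
    have hq' : q.Prime := hP q (Finset.mem_insert_self _ _)
    have hP' : ∀ p ∈ P, p.Prime := fun p hp => hP p (Finset.mem_insert_of_mem hp)
    have h1 := ih hP' he
    have h2 := ih hP' (mul_ne_zero hq'.ne_zero he)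
    have key : ∀ p ∈ P, ∀ c, q * e ∣ c → (p * (q * e) ∣ c ↔ p * e ∣ c) := by
      intro p hp c hc
      refine ⟨fun h => (Dvd.intro_left q (by ring)).trans h, fun h => ?_⟩
      have hpq : p.Coprime q :=
        (Nat.coprime_primes (hP' p hp) hq').2 fun h => hq (h ▸ hp)
      obtain ⟨d, rfl⟩ : e ∣ c := (Dvd.intro_left q rfl).trans hc
      have he' : 0 < e := Nat.pos_of_ne_zero he
      rw [mul_comm e d] at hc h ⊢
      rw [← mul_assoc]
      exact mul_dvd_mul_right (hpq.mul_dvd_of_dvd_of_dvd (Nat.dvd_of_mul_dvd_mul_right he' h)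
        (Nat.dvd_of_mul_dvd_mul_right he' hc)) _
    convert h1.sdiff h2 ?_ using 1
    · ext x
      simp only [Set.mem_ofPred_eq, Set.mem_sdiff, Finset.mem_insert, forall_eq_or_imp]
      constructor
      · rintro ⟨h1, h2, h3, h4⟩
        exact ⟨⟨h1, h2, h4⟩, fun h => h3 h.2.1⟩
      · rintro ⟨⟨h1, h2, h3⟩, h4⟩
        refine ⟨h1, h2, fun h => h4 ⟨h1, h, fun p hp => ?_⟩, h3⟩
        rw [key p hp _ h]
        exact h3 p hp
    · rw [Finset.prod_insert hq]
      have : (q : ℝ) ≠ 0 := by exact_mod_cast hq'.ne_zero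
      have : (e : ℝ) ≠ 0 := by exact_mod_cast he
      push_cast
      rw [mul_pow]
      field_simp
    · rintro x ⟨h1, h2, h3⟩
      exact ⟨h1, (Dvd.intro_left q rfl).trans h2, fun p hp h => h3 p hp ((key p hp _ h2).2 h)⟩

/-- In the last possible column the content is equidistributed modulo `q`. -/
theorem hasNaturalDensity_content_modEq {δ : ℝ} (hS : HasNaturalDensity S δ) (hk : k + 1 = n)
    {q : ℕ} (hq : q ≠ 0) (r : ℕ) :
    HasNaturalDensity {x | x ∈ S ∧ ρ.content x ≡ r [MOD q]} (δ / q) := by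
  have : NeZero q := ⟨hq⟩
  let i₀ : Fin n := ⟨k, by omega⟩
  have hcontent : ∀ x, (ρ.content x : ℤ) = |ρ.image x i₀| := by
    intro x
    rw [← Int.natCast_natAbs]
    congr 1
    refine Nat.dvd_left_iff_eq.1 fun e => ?_
    rw [content, dvd_tailGcd, ← Int.natCast_dvd]
    refine ⟨fun h => h i₀ le_rfl, fun h i hi => ?_⟩
    have : i = i₀ := Fin.ext (by simp only [i₀]; omega)
    rwa [this]
  let c : (Fin n × Fin m → ℤ) → Fin n → ℤ := fun x => (ρ.R x).1 i₀
  have hc : ∀ x v, c (shiftCol j v x) = c x := fun x v => by simp only [c, ρ.R_shift]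
  -- A shift with entries in `[0, q)` changes the linear form by at most `n * q` times its largest
  -- coefficient, so outside this slab its sign is preserved.
  have hZ := hasNaturalDensity_slab j hc (n * q)
  set Z := {x : Fin n × Fin m → ℤ | ∃ i, c x i ≠ 0 ∧
      |∑ b, c x b * x (b, j)| ≤ (n * q : ℕ) * |c x i|} with hZdef
  have hbound : ∀ x, x ∉ Z → ∀ w,
      |Matrix.mulVec (ρ.R x).1 (lift q (ρ.R x) w) i₀| < |ρ.image x i₀| := by
    intro x hx w
    have : Nonempty (Fin n) := ⟨i₀⟩
    obtain ⟨b, hb⟩ := Finite.exists_max fun b => |c x b|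
    have hb0 : c x b ≠ 0 := by
      intro h0
      have h1 : ∀ b', c x b' = 0 := fun b' => by
        have := hb b'
        rw [h0, abs_zero] at this
        exact abs_nonpos_iff.1 this
      have h2 : ((ρ.R x).1 * ((ρ.R x)⁻¹ : GL (Fin n) ℤ).1) i₀ i₀ = 1 := by
        rw [← Units.val_mul, mul_inv_cancel, Units.val_one, Matrix.one_apply_eq]
      rw [Matrix.mul_apply, Finset.sum_eq_zero fun a _ => ?_] at h2
      · exact zero_ne_one h2
      · exact mul_eq_zero_of_left (h1 a) _
    have h3 : ((n * q : ℕ) : ℤ) * |c x b| < |ρ.image x i₀| :=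
      not_le.1 fun h => hx ⟨b, hb0, h⟩
    refine lt_of_le_of_lt ?_ h3
    rw [Matrix.mulVec, dotProduct]
    refine (Finset.abs_sum_le_sum_abs _ _).trans ?_
    have h4 : ∀ b' ∈ Finset.univ, |(ρ.R x).1 i₀ b' * lift q (ρ.R x) w b'| ≤ |c x b| * q := by
      intro b' _
      rw [abs_mul, abs_of_nonneg (lift_nonneg hq _ _ _)]
      exact mul_le_mul (hb b') (lift_lt hq _ _ _).le (lift_nonneg hq _ _ _) (abs_nonneg _)
    refine (Finset.sum_le_sum h4).trans (le_of_eq ?_)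
    simp only [Finset.sum_const, Finset.card_univ, Fintype.card_fin, nsmul_eq_mul]
    push_cast
    ring
  let F : ZMod q → Set (Fin n × Fin m → ℤ) := fun g => {x | x ∈ S ∧ (ρ.content x : ZMod q) = g}
  have hFr : {x | x ∈ S ∧ ρ.content x ≡ r [MOD q]} = F r := by
    ext x
    simp only [F, Set.mem_ofPred_eq, ZMod.natCast_eq_natCast_iff]
  rw [hFr]
  convert hS.equidistributed (F := F) ?_ ?_ hZ (e := q) (fun g h => ?_) (r : ZMod q) using 2
  · rw [ZMod.card]
  · ext x
    simp [F]
  · intro g h hgh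
    exact Set.disjoint_left.2 fun x hx hx' => hgh (hx.2.symm.trans hx'.2)
  -- The content is the absolute value of the form, so a negative form must be decreased to raise
  -- the residue of the content.
  · let w : (Fin n × Fin m → ℤ) → Fin n → ℤ := fun x =>
      Pi.single i₀ (if 0 ≤ ρ.image x i₀ then ((h - g).val : ℤ) else -((h - g).val : ℤ))
    have hsign : ∀ x, x ∉ Z → (0 ≤ ρ.image (shiftCol j (lift q (ρ.R x) (w x)) x) i₀ ↔
        0 ≤ ρ.image x i₀) := by
      intro x hx
      have h1 := hbound x hx (w x)
      rw [image_shiftCol, Pi.add_apply]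
      rcases abs_cases (Matrix.mulVec (ρ.R x).1 (lift q (ρ.R x) (w x)) i₀) with h2 | h2 <;>
      rcases abs_cases (ρ.image x i₀) with h3 | h3 <;> omega
    refine ⟨fun x => shiftCol j (lift q (ρ.R x) (w x)) x, ?_, ?_,
      fun x i => abs_shiftCol_lift_sub_le hq _ _ _ _⟩
    · rintro x ⟨⟨hx, hg⟩, hxZ⟩
      refine ⟨ρ.shift_mem x hx _, ?_⟩
      have h1 : ((ρ.content (shiftCol j (lift q (ρ.R x) (w x)) x) : ℤ) : ZMod q) = h := by
        have h2 : ((ρ.content x : ℤ) : ZMod q) = g := by rw [← hg]; simp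
        rw [hcontent] at h2 ⊢
        by_cases h0 : 0 ≤ ρ.image x i₀
        · rw [abs_of_nonneg h0] at h2
          rw [abs_of_nonneg ((hsign x hxZ).2 h0), image_shiftCol, Pi.add_apply, Int.cast_add,
            mulVec_lift, h2]
          simp [w, h0]
        · rw [abs_of_neg (not_le.1 h0), Int.cast_neg] at h2
          rw [abs_of_neg (not_le.1 ((hsign x hxZ).not.2 h0)), image_shiftCol, Pi.add_apply,
            Int.cast_neg, Int.cast_add, mulVec_lift, neg_add, h2]
          simp [w, h0]
      simpa using h1
    · rintro x ⟨-, hx⟩ y ⟨-, hy⟩ hxy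
      simp only at hxy
      have hR := congrArg ρ.R hxy
      simp only [ρ.R_shift] at hR
      -- The sign is unchanged by the shift, so it can be read off from the common image.
      have hw : w x = w y := by
        have h1 := hsign x hx
        rw [hxy, hsign y hy] at h1
        simp only [w, h1]
      rw [hR, hw] at hxy
      exact shiftCol_injective _ _ hxy

end ColumnReduction
end

/-! ### Large prime divisors of the content -/

theorem ncard_le_three {T : Set ℤ} {p : ℕ}
    (h : ∀ s ∈ T, ∀ t ∈ T, (p : ℤ) ∣ s - t ∧ |s - t| < 2 * p) : T.ncard ≤ 3 := by
  rcases T.eq_empty_or_nonempty with rfl | ⟨t, ht⟩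
  · simp
  · have hsub : T ⊆ (({t, t + p, t - p} : Finset ℤ) : Set ℤ) := by
      intro s hs
      obtain ⟨⟨u, hu⟩, h2⟩ := h s hs t ht
      have hs' : s = t + p * u := by linarith
      rw [hu, abs_mul, mul_comm, Nat.abs_cast] at h2
      have h3 : |u| < 2 := lt_of_mul_lt_mul_right h2 (Int.natCast_nonneg _)
      have h4 : u = 0 ∨ u = 1 ∨ u = -1 := by rw [abs_lt] at h3; omega
      rcases h4 with rfl | rfl | rfl <;> simp [hs', sub_eq_add_neg]
    refine (Set.ncard_le_ncard hsub (Finset.finite_toSet _)).trans ?_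
    rw [Set.ncard_coe_finset]
    exact Finset.card_le_three

/-- The product of the distinct prime factors exceeding `B` divides `s`, so it is at most `B ^ K`.
-/
theorem card_large_primeFactors_le {s : ℤ} (hs : s ≠ 0) {B : ℝ} (hB : 1 < B) {K : ℕ}
    (h : |(s : ℝ)| ≤ B ^ K) : (s.natAbs.primeFactors.filter fun p : ℕ => B < (p : ℝ)).card ≤ K := by
  set P := s.natAbs.primeFactors.filter fun p : ℕ => B < (p : ℝ)
  have h1 : ∏ p ∈ P, p ∣ s.natAbs :=
    (Finset.prod_dvd_prod_of_subset _ _ _ (Finset.filter_subset _ _)).trans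
      (Nat.prod_primeFactors_dvd _)
  have h2 : ((∏ p ∈ P, p : ℕ) : ℝ) ≤ |(s : ℝ)| := by
    rw [← Int.cast_abs, Int.abs_eq_natAbs]
    exact_mod_cast Nat.le_of_dvd (Int.natAbs_pos.2 hs) h1
  have h3 : B ^ P.card ≤ ((∏ p ∈ P, p : ℕ) : ℝ) := by
    rw [Nat.cast_prod, ← Finset.prod_const]
    exact Finset.prod_le_prod (fun _ _ => by linarith) fun p hp => (Finset.mem_filter.1 hp).2.le
  exact (pow_le_pow_iff_right₀ hB).1 ((h3.trans h2).trans h)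

section
variable {n m : ℕ}

/-- Siegel's lemma for the vectors orthogonal to the columns before `j` and to a unit vector. -/
theorem exists_small_orthogonal {j : Fin m} (hj : (j : ℕ) + 1 < n) (y : Fin n × Fin m → ℤ)
    (i' : Fin n) : ∃ ℓ : Fin n → ℤ, ℓ ≠ 0 ∧ ℓ i' = 0 ∧ (∀ l < j, ∑ i, ℓ i * y (i, l) = 0) ∧
      ∀ D : ℝ, 1 ≤ D → (∀ i, ∀ l < j, |(y (i, l) : ℝ)| ≤ D) → ∀ i, |(ℓ i : ℝ)| ≤ (n * D) ^ n := by
  -- The row `none` encodes `ℓ i' = 0`. There are `j + 1 < n` equations, and Siegel's exponent `(j +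
  -- 1) / (n - (j + 1))` is at most `n`.
  let A : Matrix (Option {l : Fin m // l < j}) (Fin n) ℤ :=
    fun o i => o.elim ((Pi.single i' 1 : Fin n → ℤ) i) fun l => y (i, l)
  have hcard : Fintype.card (Option {l : Fin m // l < j}) = j + 1 := by
    rw [Fintype.card_option, Fintype.card_subtype]
    congr 1
    rw [← Fin.card_Iio j]
    congr 1
    ext i; simp
  obtain ⟨ℓ, h1, h2, h3⟩ := Int.Matrix.exists_ne_zero_int_vec_norm_le A
    (by rw [hcard, Fintype.card_fin]; exact hj) (by rw [hcard]; omega)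
  refine ⟨ℓ, h1, ?_, fun l hl => ?_, fun D hD h i => ?_⟩
  · have := congrFun h2 none
    simpa [A, Matrix.mulVec, dotProduct, Pi.single_apply] using this
  · have := congrFun h2 (some ⟨l, hl⟩)
    simp only [A, Matrix.mulVec, dotProduct, Option.elim_some, Pi.zero_apply] at this
    rw [← this]
    exact Finset.sum_congr rfl fun _ _ => mul_comm _ _
  · have h4 := (norm_le_pi_norm ℓ i).trans h3
    rw [Int.norm_eq_abs] at h4
    refine h4.trans ?_
    rw [hcard, Fintype.card_fin]
    have hn : (1 : ℝ) ≤ n := by exact_mod_cast (by omega : 1 ≤ n)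
    rw [← Real.rpow_natCast ((n : ℝ) * D) n]
    have hA : ∀ o i, ‖A o i‖ ≤ D := by
      intro o i
      rw [Int.norm_eq_abs]
      rcases o with _ | l
      · by_cases hi : i = i'
        · subst hi; simpa [A] using hD
        · simpa [A, hi] using zero_le_one.trans hD
      · exact h i l l.2
    refine (Real.rpow_le_rpow (by positivity) (mul_le_mul_of_nonneg_left
      (max_le hD ((Matrix.norm_le_iff (by linarith)).2 hA)) (by positivity)) ?_).trans
      (Real.rpow_le_rpow_of_exponent_le ?_ ?_)
    · refine div_nonneg (by positivity) ?_
      have : ((j : ℕ) : ℝ) + 1 < n := by exact_mod_cast hj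
      push_cast; linarith
    · nlinarith
    · have : ((j : ℕ) : ℝ) + 1 + 1 ≤ n := by exact_mod_cast hj
      push_cast
      rw [div_le_iff₀ (by linarith)]
      nlinarith

namespace ColumnReduction
variable {S : Set (Fin n × Fin m → ℤ)} {k : ℕ} {j : Fin m} (ρ : ColumnReduction S k j)

/-- The pairing of `ℓ` with column `j` is the pairing of `ℓ R⁻¹` with the image of the column, and
`ℓ R⁻¹` vanishes before index `k`. -/
theorem dvd_of_dvd_content {x : Fin n × Fin m → ℤ} (hx : x ∈ S) {ℓ : Fin n → ℤ}
    (hℓ : ∀ l < j, ∑ i, ℓ i * x (i, l) = 0) {p : ℕ} (hp : p ∣ ρ.content x) :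
    (p : ℤ) ∣ ∑ b, ℓ b * x (b, j) := by
  have h1 : Matrix.mulVec ((ρ.R x)⁻¹ : GL (Fin n) ℤ).1 (ρ.image x) = fun b => x (b, j) := by
    change Matrix.mulVec _ (Matrix.mulVec (ρ.R x).1 fun b => x (b, j)) = _
    rw [Matrix.mulVec_mulVec, ← Units.val_mul, inv_mul_cancel, Units.val_one, Matrix.one_mulVec]
  have h2 : ∑ b, ℓ b * x (b, j) =
      dotProduct (Matrix.vecMul ℓ ((ρ.R x)⁻¹ : GL (Fin n) ℤ).1) (ρ.image x) := by
    rw [← Matrix.dotProduct_mulVec, h1]; rfl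
  rw [h2]
  refine Finset.dvd_sum fun i _ => ?_
  rcases lt_or_ge (i : ℕ) k with hi | hi
  · rw [ρ.vecMul_inv_eq_zero x hx ℓ hℓ i hi, zero_mul]
    exact dvd_zero _
  · exact (dvd_tailGcd.1 hp i hi).mul_left _

theorem exists_not_dvd (x : Fin n × Fin m → ℤ) (a : Fin n) {p : ℕ} (hp : p.Prime) :
    ∃ i', ¬ (p : ℤ) ∣ (ρ.R x).1 a i' := by
  by_contra! h
  have h2 : ((ρ.R x).1 * ((ρ.R x)⁻¹ : GL (Fin n) ℤ).1) a a = 1 := by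
    rw [← Units.val_mul, mul_inv_cancel, Units.val_one, Matrix.one_apply_eq]
  rw [Matrix.mul_apply] at h2
  have h3 : (p : ℤ) ∣ 1 := by
    rw [← h2]
    exact Finset.dvd_sum fun b _ => (h b).mul_right _
  exact hp.one_lt.ne' (Nat.dvd_one.1 (by exact_mod_cast h3))

/-- Up to a set of density zero, few points in a cube have a content divisible by a prime that
exceeds the size of the cube. -/
theorem exists_count_large_prime_le (hjk : (j : ℕ) = k) (hk : k + 1 < n) :
    ∃ (Z : Set (Fin n × Fin m → ℤ)) (C : ℝ), HasNaturalDensity Z 0 ∧ ∀ z, ∀ᶠ B : ℝ in atTop,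
      count {x | x ∈ S ∧ ∃ p : ℕ, p.Prime ∧ B < p ∧ p ∣ ρ.content x} z B ≤
        count Z z B + C * (2 * B + 1) ^ (Fintype.card (Fin n × Fin m) - 1) := by
  -- Choosing `ℓ` from the truncation makes it independent of column `j`.
  let trunc : (Fin n × Fin m → ℤ) → Fin n × Fin m → ℤ := fun x p => if p.2 < j then x p else 0
  have htrunc : ∀ x v, trunc (shiftCol j v x) = trunc x := by
    intro x v
    ext ⟨i, l⟩
    simp only [trunc]
    split_ifs with h
    · exact shiftCol_apply_of_ne h.ne v x i
    · rfl
  have htr : ∀ x i, ∀ l < j, trunc x (i, l) = x (i, l) := fun x i l hl => if_pos hl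
  choose ℓ hℓ0 hℓi hℓy hℓD using
    fun (y : Fin n × Fin m → ℤ) (i' : Fin n) => exists_small_orthogonal (j := j) (by omega) y i'
  let L : Fin n → (Fin n × Fin m → ℤ) → Fin n → ℤ := fun i' x => ℓ (trunc x) i'
  have hL : ∀ i' x v, L i' (shiftCol j v x) = L i' x := fun i' x v => by simp only [L, htrunc]
  have horth : ∀ i' x, ∀ l < j, ∑ i, L i' x i * x (i, l) = 0 := by
    intro i' x l hl
    rw [← hℓy (trunc x) i' l hl]
    exact Finset.sum_congr rfl fun i _ => by rw [htr x i l hl]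
  let s : Fin n → (Fin n × Fin m → ℤ) → ℤ := fun i' x => ∑ b, L i' x b * x (b, j)
  let a : Fin n := ⟨k, by omega⟩
  let Z : Fin n → Set (Fin n × Fin m → ℤ) := fun i' => {x | ∃ i, L i' x i ≠ 0 ∧
    |∑ b, L i' x b * x (b, j)| ≤ (0 : ℕ) * |L i' x i|}
  -- As `ℓ i' = 0`, the integer `s i' x` does not involve the coordinate `(i', j)`, whereas `image x
  -- a` depends on it with a coefficient prime to `p`. The first divisibility limits `p`, the second
  -- the coordinate.
  let Y : ℝ → Fin n → Set (Fin n × Fin m → ℤ) := fun B i' => {x | s i' x ≠ 0 ∧ ∃ p : ℕ, p.Prime ∧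
    B < p ∧ (p : ℤ) ∣ s i' x ∧ ¬ (p : ℤ) ∣ (ρ.R x).1 a i' ∧ (p : ℤ) ∣ ρ.image x a}
  have hY : ∀ z : Fin n × Fin m → ℤ, ∀ᶠ B : ℝ in atTop, ∀ i', count (Y B i') z B ≤
      ((2 * (n + 1) * 3 : ℕ) : ℝ) * (2 * B + 1) ^ (Fintype.card (Fin n × Fin m) - 1) := by
    intro z
    have hz : ∀ᶠ B : ℝ in atTop, ∀ p, |(z p : ℝ)| ≤ B :=
      eventually_all.2 fun p => eventually_ge_atTop _
    filter_upwards [hz, eventually_gt_atTop 1, eventually_ge_atTop (2 * n : ℝ)] with B hz hB1 hBn i'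
    refine count_le_of_fibre (i', j) (by linarith) fun x hx => ?_
    have hx2 : ∀ p, |(x p : ℝ)| ≤ 2 * B := by
      intro p
      have := hx.2 p
      have := abs_le.1 (hz p)
      rw [abs_le]; constructor <;> linarith
    have hs : |(s i' x : ℝ)| ≤ B ^ (2 * (n + 1)) := by
      have h1 : ∀ b, |(L i' x b : ℝ)| ≤ (n * (2 * B)) ^ n :=
        hℓD (trunc x) i' (2 * B) (by linarith) fun i l hl => by rw [htr x i l hl]; exact hx2 _
      have h2 : |(s i' x : ℝ)| ≤ ∑ b : Fin n, (n * (2 * B)) ^ n * (2 * B) := by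
        simp only [s]
        push_cast
        refine (Finset.abs_sum_le_sum_abs _ _).trans (Finset.sum_le_sum fun b _ => ?_)
        rw [abs_mul]
        exact mul_le_mul (h1 b) (hx2 _) (abs_nonneg _) (by positivity)
      rw [Finset.sum_const, Finset.card_univ, Fintype.card_fin, nsmul_eq_mul] at h2
      calc |(s i' x : ℝ)| ≤ (n * (2 * B)) ^ (n + 1) := by rw [pow_succ]; linarith
        _ ≤ (B ^ 2) ^ (n + 1) := pow_le_pow_left₀ (by positivity) (by nlinarith) _
        _ = B ^ (2 * (n + 1)) := by rw [← pow_mul]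
    have hsup : ∀ t, s i' (Function.update x (i', j) t) = s i' x := by
      intro t
      simp only [s]
      rw [sum_mul_update, update_eq_shiftCol, hL, show L i' x i' = 0 from hℓi _ _, zero_mul,
        add_zero]
    have hRup : ∀ t, ρ.R (Function.update x (i', j) t) = ρ.R x := fun t => by
      rw [update_eq_shiftCol, ρ.R_shift]
    let P := (s i' x).natAbs.primeFactors.filter fun p : ℕ => B < (p : ℝ)
    let T : ℕ → Set ℤ := fun p => {t | Function.update x (i', j) t ∈ cube z B ∧ B < p ∧ p.Prime ∧
      ¬ (p : ℤ) ∣ (ρ.R x).1 a i' ∧ (p : ℤ) ∣ ρ.image (Function.update x (i', j) t) a}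
    -- Two values are congruent modulo `p` and lie in an interval of length `2 * B < 2 * p`.
    have hT : ∀ p, (T p).ncard ≤ 3 := by
      refine fun p => ncard_le_three (p := p) fun t ht t' ht' => ⟨?_, ?_⟩
      · have h1 := dvd_sub ht.2.2.2.2 ht'.2.2.2.2
        simp only [image, hRup] at h1
        rw [sum_mul_update, sum_mul_update] at h1
        ring_nf at h1
        rw [← mul_sub] at h1
        exact ((Nat.prime_iff_prime_int.1 ht.2.2.1).dvd_or_dvd h1).resolve_left ht.2.2.2.1
      · have h1 := ht.1 (i', j)
        have h2 := ht'.1 (i', j)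
        simp only [Function.update_self] at h1 h2
        have h3 : |(t : ℝ) - t'| < 2 * p := by
          have := ht.2.1
          rw [abs_lt]; constructor <;> linarith
        exact_mod_cast h3
    calc _ ≤ (⋃ p ∈ P, T p).ncard := by
            refine Set.ncard_le_ncard ?_ ?_
            · rintro t ⟨⟨h0, p, hp, hBp, hps, hpR, hpi⟩, ht⟩
              rw [hsup] at h0 hps
              rw [hRup] at hpR
              refine Set.mem_biUnion (x := p) ?_ ⟨ht, hBp, hp, hpR, hpi⟩
              exact Finset.mem_filter.2 ⟨Nat.mem_primeFactors.2
                ⟨hp, Int.natCast_dvd.1 hps, Int.natAbs_ne_zero.2 h0⟩, hBp⟩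
            · refine (Set.finite_Ico ⌈(z (i', j) : ℝ) - B⌉ ⌈(z (i', j) : ℝ) + B⌉).subset ?_
              intro t ht
              obtain ⟨p, -, ht⟩ := Set.mem_iUnion₂.1 ht
              have := ht.1 (i', j)
              simp only [Function.update_self] at this
              exact ⟨Int.ceil_le.2 this.1, Int.lt_ceil.2 this.2⟩
      _ ≤ ∑ p ∈ P, (T p).ncard := Finset.set_ncard_biUnion_le _ _
      _ ≤ ∑ p ∈ P, 3 := Finset.sum_le_sum fun p _ => hT p
      _ = P.card * 3 := by rw [Finset.sum_const, smul_eq_mul]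
      _ ≤ _ := Nat.mul_le_mul_right _ (card_large_primeFactors_le hx.1.1 hB1 hs)
  have hZ : HasNaturalDensity (⋃ i' ∈ (Finset.univ : Finset (Fin n)), Z i') 0 :=
    hasNaturalDensity_biUnion_zero _ fun i' _ => hasNaturalDensity_slab j (hL i') 0
  refine ⟨_, n * (2 * (n + 1) * 3 : ℕ), hZ, fun z => ?_⟩
  filter_upwards [hY z] with B hB
  calc _ ≤ count ((⋃ i' ∈ (Finset.univ : Finset (Fin n)), Z i') ∪
        ⋃ i' ∈ (Finset.univ : Finset (Fin n)), Y B i') z B := by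
        refine count_mono ?_
        rintro x ⟨⟨hx, p, hp, hBp, hpc⟩, -⟩
        obtain ⟨i', hi'⟩ := ρ.exists_not_dvd x a hp
        by_cases hs : s i' x = 0
        · left
          refine Set.mem_biUnion (Finset.mem_univ i') ?_
          obtain ⟨i, hi⟩ := Function.ne_iff.1 (hℓ0 (trunc x) i')
          refine ⟨i, hi, ?_⟩
          rw [Nat.cast_zero, zero_mul]
          exact (abs_eq_zero.2 hs).le
        · right
          refine Set.mem_biUnion (Finset.mem_univ i') ⟨hs, p, hp, hBp, ?_, hi', ?_⟩
          · exact ρ.dvd_of_dvd_content hx (horth i' x) hpc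
          · exact dvd_tailGcd.1 hpc a le_rfl
    _ ≤ _ := count_union_le _ _ _ _
    _ ≤ _ := by
        gcongr
        refine (count_iUnion_le _ _ _ _).trans ((Finset.sum_le_sum fun i _ => hB i).trans ?_)
        rw [Finset.sum_const, Finset.card_univ, Fintype.card_fin, nsmul_eq_mul, ← mul_assoc]

end ColumnReduction
end

/-! ### The density of a prescribed content -/

/-- The Euler product of `ζ(r)⁻¹` over the reals. -/
theorem exists_tendsto_prod_one_sub {r : ℕ} (hr : 1 < r) : ∃ c : ℝ,
    (c : ℂ) = (riemannZeta (r : ℂ))⁻¹ ∧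
    Tendsto (fun N : ℕ => ∏ p ∈ N.primesBelow, (1 - ((p : ℝ) ^ r)⁻¹)) atTop (𝓝 c) := by
  have hre : 1 < ((r : ℂ)).re := by simpa using hr
  have h1 := (riemannZeta_eulerProduct hre).inv₀ (riemannZeta_ne_zero_of_one_lt_re hre)
  have h2 : Tendsto (fun N : ℕ => ((∏ p ∈ N.primesBelow, (1 - ((p : ℝ) ^ r)⁻¹) : ℝ) : ℂ)) atTop
      (𝓝 (riemannZeta (r : ℂ))⁻¹) := by
    refine h1.congr fun N => ?_
    rw [← Finset.prod_inv_distrib]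
    push_cast
    refine Finset.prod_congr rfl fun p _ => ?_
    rw [inv_inv, Complex.cpow_neg, Complex.cpow_natCast]
  have h3 : Tendsto (fun N : ℕ => ∏ p ∈ N.primesBelow, (1 - ((p : ℝ) ^ r)⁻¹)) atTop
      (𝓝 ((riemannZeta (r : ℂ))⁻¹).re) := by
    simpa only [Function.comp_def, Complex.ofReal_re] using
      (Complex.continuous_re.tendsto _).comp h2
  exact ⟨_, tendsto_nhds_unique ((Complex.continuous_ofReal.tendsto _).comp h3) h2, h3⟩

namespace ColumnReduction
variable {n m : ℕ} {S : Set (Fin n × Fin m → ℤ)} {k : ℕ} {j : Fin m} (ρ : ColumnReduction S k j)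

/-- The term `3 ^ N` comes from `M < p ≤ B`, where `2 * (B + p) + 1 ≤ 3 * (2 * B)` and `n - k ≥ 2`
make the sum converge; the term `1` absorbs the primes above `B`, whose share tends to 0. -/
theorem eventually_count_prime_le (hjk : (j : ℕ) = k) (hk : k + 1 < n) {M : ℕ} (hM : M ≠ 0)
    (z : Fin n × Fin m → ℤ) : ∀ᶠ B : ℝ in atTop,
      count {x | x ∈ S ∧ ∃ p : ℕ, p.Prime ∧ M < p ∧ p ∣ ρ.content x} z B /
        (2 * B) ^ Fintype.card (Fin n × Fin m) ≤
      ((3 : ℝ) ^ Fintype.card (Fin n × Fin m) + 1) * (M : ℝ)⁻¹ := by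
  have hM0 : (0 : ℝ) < M := by exact_mod_cast Nat.pos_of_ne_zero hM
  have hcard : Fintype.card (Fin n × Fin m) ≠ 0 := by
    have : Nonempty (Fin n × Fin m) := ⟨(⟨k, by omega⟩, j)⟩
    exact Fintype.card_ne_zero
  set N := Fintype.card (Fin n × Fin m)
  obtain ⟨Z, C, hZ, hcount⟩ := ρ.exists_count_large_prime_le hjk hk
  have hlim := (hZ z).add (tendsto_const_mul_pow_pred_div C hcard)
  rw [add_zero] at hlim
  filter_upwards [hcount z, hlim.eventually (gt_mem_nhds (inv_pos.2 hM0)),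
    eventually_ge_atTop (1 : ℝ), eventually_ge_atTop (M : ℝ)] with B h1 h2 hB hBM
  change count Z z B / _ + _ < _ at h2
  have hB0 : (0 : ℝ) < (2 * B) ^ N := by positivity
  rw [div_le_iff₀ hB0]
  rw [← add_div, div_lt_iff₀ hB0] at h2
  have hp : ∀ p ∈ Finset.Ioc M ⌊B⌋₊, count {x | x ∈ S ∧ p ∣ ρ.content x} z B ≤
      3 ^ N * (2 * B) ^ N * ((p : ℝ) ^ 2)⁻¹ := by
    intro p hp
    obtain ⟨hp1, hp2⟩ := Finset.mem_Ioc.1 hp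
    have hpB : (p : ℝ) ≤ B := (Nat.le_floor_iff (by linarith)).1 hp2
    have hp0 : (1 : ℝ) ≤ p := by exact_mod_cast (by omega : 1 ≤ p)
    rw [le_mul_inv_iff₀ (by positivity), mul_comm]
    calc _ ≤ (p : ℝ) ^ (n - k) * count {x | x ∈ S ∧ p ∣ ρ.content x} z B := by
          refine mul_le_mul_of_nonneg_right ?_ (count_nonneg _ _ _)
          exact pow_le_pow_right₀ hp0 (by omega)
      _ ≤ count S z (B + p) := ρ.count_dvd_le (by omega) (by omega) z B
      _ ≤ (2 * (B + p) + 1) ^ N := count_le (by linarith)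
      _ ≤ (3 * (2 * B)) ^ N := pow_le_pow_left₀ (by positivity) (by linarith) _
      _ = _ := mul_pow _ _ _
  have hsum : ∑ p ∈ Finset.Ioc M ⌊B⌋₊, ((p : ℝ) ^ 2)⁻¹ ≤ (M : ℝ)⁻¹ := by
    refine (sum_Ioc_inv_sq_le_sub hM (Nat.le_floor hBM)).trans ?_
    rw [sub_le_self_iff]
    positivity
  calc _ ≤ count ((⋃ p ∈ Finset.Ioc M ⌊B⌋₊, {x | x ∈ S ∧ p ∣ ρ.content x}) ∪
        {x | x ∈ S ∧ ∃ p : ℕ, p.Prime ∧ B < p ∧ p ∣ ρ.content x}) z B := by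
        refine count_mono ?_
        rintro x ⟨⟨hx, p, hp, hMp, hpc⟩, -⟩
        rcases le_or_gt (p : ℝ) B with hpB | hpB
        · exact Or.inl (Set.mem_biUnion (Finset.mem_coe.2 (Finset.mem_Ioc.2
            ⟨hMp, Nat.le_floor hpB⟩)) ⟨hx, hpc⟩)
        · exact Or.inr ⟨hx, p, hp, hpB, hpc⟩
    _ ≤ _ := count_union_le _ _ _ _
    _ ≤ 3 ^ N * (2 * B) ^ N * (M : ℝ)⁻¹ + (M : ℝ)⁻¹ * (2 * B) ^ N := by
        refine add_le_add ?_ (h1.trans h2.le)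
        refine (count_iUnion_le _ _ _ _).trans ((Finset.sum_le_sum hp).trans ?_)
        rw [← Finset.mul_sum]
        exact mul_le_mul_of_nonneg_left hsum (by positivity)
    _ = _ := by ring

/-- The approximating sets require `a` to divide the content and `p * a` not to, for primes `p < M +
2`. A surplus point has a content divisible by some prime exceeding `M + 1`. -/
theorem hasNaturalDensity_content_eq {δ : ℝ} (hS : HasNaturalDensity S δ) (hjk : (j : ℕ) = k)
    (hk : k + 1 < n) {a : ℕ} (ha : a ≠ 0) {c : ℝ}
    (hc : Tendsto (fun N : ℕ => ∏ p ∈ N.primesBelow, (1 - ((p : ℝ) ^ (n - k))⁻¹)) atTop (𝓝 c)) :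
    HasNaturalDensity {x | x ∈ S ∧ ρ.content x = a} (δ / (a : ℝ) ^ (n - k) * c) := by
  refine hasNaturalDensity_of_approx (fun M => ρ.hasNaturalDensity_dvd_not_dvd hS (by omega)
    (M + 2).primesBelow (fun p hp => Nat.prime_of_mem_primesBelow hp) ha) ?_
    ((hc.comp (tendsto_add_atTop_nat 2)).const_mul _)
    (ε := fun M => ((3 : ℝ) ^ Fintype.card (Fin n × Fin m) + 1) * ((M + 1 : ℕ) : ℝ)⁻¹) ?_ ?_
  · rintro M x ⟨hx, h⟩
    refine ⟨hx, h ▸ dvd_rfl, fun p hp hpa => ?_⟩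
    rw [h] at hpa
    have h1 := Nat.le_of_dvd (Nat.pos_of_ne_zero ha) hpa
    have h2 := (Nat.prime_of_mem_primesBelow hp).two_le
    have h3 := Nat.pos_of_ne_zero ha
    nlinarith
  · have := (tendsto_inv_atTop_zero.comp ((tendsto_natCast_atTop_atTop (R := ℝ)).comp
      (tendsto_add_atTop_nat 1))).const_mul ((3 : ℝ) ^ Fintype.card (Fin n × Fin m) + 1)
    rw [mul_zero] at this
    exact this
  · intro M z
    filter_upwards [ρ.eventually_count_prime_le hjk hk (Nat.succ_ne_zero M) z,
      eventually_ge_atTop 0] with B h hB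
    refine (div_le_div_of_nonneg_right (count_mono ?_) (by positivity)).trans h
    rintro x ⟨⟨⟨hx, h1, h2⟩, h3⟩, -⟩
    refine ⟨hx, ?_⟩
    have h4 : ρ.content x ≠ a := fun h => h3 ⟨hx, h⟩
    obtain ⟨b, hb⟩ := h1
    by_cases hb0 : b = 0
    -- Content zero is divisible by any large prime.
    · obtain ⟨p, hp1, hp2⟩ := Nat.exists_infinite_primes (M + 2)
      exact ⟨p, hp2, by omega, by rw [hb, hb0, mul_zero]; exact dvd_zero _⟩
    · obtain ⟨p, hp, hpb⟩ := Nat.exists_prime_and_dvd (n := b) fun h => h4 (by rw [hb, h, mul_one])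
      refine ⟨p, hp, ?_, hb ▸ hpb.mul_left _⟩
      by_contra hpM
      refine h2 p (Nat.mem_primesBelow.2 ⟨by omega, hp⟩) ?_
      rw [hb, mul_comm p]
      exact mul_dvd_mul_left a hpb

end ColumnReduction

/-! ### The diagonal of the Hermite normal form -/

section
variable {n m k : ℕ}

/-- The matrices of a set, as functions on pairs of indices. -/
def uncurried (S : Set (Matrix (Fin n) (Fin m) ℤ)) : Set (Fin n × Fin m → ℤ) :=
  {x | Matrix.of (fun i j => x (i, j)) ∈ S}

/-- The first `k` columns, followed by zeros. -/
def firstColumns (k : ℕ) (x : Fin n × Fin m → ℤ) : Matrix (Fin n) (Fin m) ℤ :=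
  Matrix.of fun i l => if (l : ℕ) < k then x (i, l) else 0

/-- A triangularizing matrix that depends on the first `k` columns only. -/
noncomputable def reducer (hk : k ≤ min n m) (d : Fin k → ℕ) (x : Fin n × Fin m → ℤ) :
    GL (Fin n) ℤ :=
  Classical.epsilon fun U => Triangularizes hk d U (firstColumns k x)

theorem triangularizes_reducer {hk : k ≤ min n m} {d : Fin k → ℕ} {x : Fin n × Fin m → ℤ}
    (hx : x ∈ uncurried (Delta hk d)) :
    Triangularizes hk d (reducer hk d x) (Matrix.of fun i l => x (i, l)) := by
  have h : ∃ U, Triangularizes hk d U (firstColumns k x) := by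
    obtain ⟨U, hU⟩ := exists_triangularizes hx
    exact ⟨U, hU.congr fun i l hl => by simp [firstColumns, hl]⟩
  exact (Classical.epsilon_spec h).congr fun i l hl => by simp [firstColumns, hl]

/-- The reduction of the first `k` columns of the matrices in `Delta hk d`. -/
noncomputable def deltaReduction (hk : k + 1 ≤ min n m) (d : Fin k → ℕ) (hd : ∀ i, d i ≠ 0) :
    ColumnReduction (uncurried (Delta ((Nat.le_succ k).trans hk) d)) k
      ⟨k, hk.trans (min_le_right n m)⟩ where
  R := reducer ((Nat.le_succ k).trans hk) d
  shift_mem := by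
    intro x hx v
    obtain ⟨U, hU⟩ := exists_triangularizes (hk := (Nat.le_succ k).trans hk) hx
    refine (hU.congr fun i l hl => ?_).mem_delta hd
    exact (shiftCol_apply_of_ne (by rintro rfl; exact lt_irrefl _ hl) v x i).symm
  R_shift := by
    intro x v
    have : firstColumns k (shiftCol ⟨k, hk.trans (min_le_right n m)⟩ v x) = firstColumns k x := by
      ext i l
      simp only [firstColumns, Matrix.of_apply]
      split_ifs with hl
      · exact shiftCol_apply_of_ne (by rintro rfl; exact lt_irrefl _ hl) v x i
      · rfl
    simp only [reducer, this]
  vecMul_inv_eq_zero := by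
    intro x hx ℓ hℓ
    have hU := triangularizes_reducer hx
    set U := reducer ((Nat.le_succ k).trans hk) d x
    set A : Matrix (Fin n) (Fin m) ℤ := Matrix.of fun i l => x (i, l)
    have h1 : Matrix.vecMul (Matrix.vecMul ℓ (U⁻¹ : GL (Fin n) ℤ).1) (U.1 * A) =
        Matrix.vecMul ℓ A := by
      rw [Matrix.vecMul_vecMul, ← Matrix.mul_assoc, ← Units.val_mul, inv_mul_cancel,
        Units.val_one, Matrix.one_mul]
    -- Forward substitution: column `i` of the triangular matrix gives an equation in the
    -- coordinates up to `i`, with nonzero leading coefficient `d i`.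
    intro i
    induction i using WellFoundedLT.induction with
    | _ i ih =>
    intro hi
    have h2 := congrFun h1 ⟨i, hi.trans (hk.trans (min_le_right n m))⟩
    have h3 : Matrix.vecMul ℓ A ⟨i, hi.trans (hk.trans (min_le_right n m))⟩ = 0 := hℓ _ hi
    rw [h3, Matrix.vecMul, dotProduct, Finset.sum_eq_single i] at h2
    · refine (mul_eq_zero.1 h2).resolve_right ?_
      refine ((hU ⟨i, hi⟩ i le_rfl).trans (if_pos rfl)).trans_ne ?_
      exact_mod_cast hd _
    · intro b _ hb
      rcases lt_or_gt_of_ne hb with h | h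
      · rw [ih b h (lt_trans h hi), zero_mul]
      · refine mul_eq_zero_of_right _ ((hU ⟨i, hi⟩ b (Fin.lt_def.1 h).le).trans (if_neg ?_))
        exact (Fin.lt_def.1 h).ne'
    · simp

theorem uncurried_delta_snoc (hk : k + 1 ≤ min n m) (d : Fin k → ℕ) (hd : ∀ i, d i ≠ 0) (a : ℕ) :
    uncurried (Delta hk (Fin.snoc (α := fun _ => ℕ) d a)) =
      {x : Fin n × Fin m → ℤ | x ∈ uncurried (Delta ((Nat.le_succ k).trans hk) d) ∧
        (deltaReduction hk d hd).content x = a} := by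
  have key : ∀ x ∈ uncurried (Delta ((Nat.le_succ k).trans hk) d),
      x ∈ uncurried (Delta hk (Fin.snoc (α := fun _ => ℕ) d a)) ↔
        (deltaReduction hk d hd).content x = a :=
    fun x hx => mem_delta_succ_iff (hk := hk) hd (triangularizes_reducer hx) a
  ext x
  constructor
  · intro hx
    have h1 : x ∈ uncurried (Delta ((Nat.le_succ k).trans hk) d) := by
      have := delta_init (hk := hk) hx
      rwa [Fin.init_snoc] at this
    exact ⟨h1, (key x h1).1 hx⟩
  · rintro ⟨h1, h2⟩
    exact (key x h1).2 h2

theorem hasMatrixDensity_delta (hk : k ≤ min n m) (hkn : k < n) (d : Fin k → ℕ)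
    (hd : ∀ i, d i ≠ 0) : ∃ δ : ℝ, HasMatrixDensity (Delta hk d) δ ∧
      (δ : ℂ) = ((∏ i : Fin k, riemannZeta ((n - (i : ℕ) : ℕ) : ℂ)) *
        ∏ i : Fin k, (d i : ℂ) ^ (n - (i : ℕ)))⁻¹ := by
  induction k with
  | zero =>
    refine ⟨1, ?_, by simp⟩
    have : Delta hk d = Set.univ := Set.eq_univ_of_forall fun A => by
      obtain ⟨d', hd'⟩ := exists_mem_delta hk A
      rwa [Subsingleton.elim d d']
    rw [this]
    exact hasNaturalDensity_univ
  | succ k ih =>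
    have hd' : ∀ i, Fin.init d i ≠ 0 := fun i => hd i.castSucc
    obtain ⟨δ, h1, h2⟩ := ih ((Nat.le_succ k).trans hk) (by omega) (Fin.init d) hd'
    obtain ⟨c, hc1, hc2⟩ := exists_tendsto_prod_one_sub (r := n - k) (by omega)
    refine ⟨δ / (d (Fin.last k) : ℝ) ^ (n - k) * c, ?_, ?_⟩
    · have h3 := (deltaReduction hk _ hd').hasNaturalDensity_content_eq h1 rfl hkn
        (hd (Fin.last k)) hc2
      rw [← uncurried_delta_snoc hk _ hd', Fin.snoc_init_self] at h3
      exact h3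
    · push_cast
      rw [h2, hc1, Fin.prod_univ_castSucc, Fin.prod_univ_castSucc]
      simp only [Fin.init, Fin.val_castSucc, Fin.val_last, mul_inv, div_eq_mul_inv]
      ring

/-- At the first zero of the diagonal the earlier entries are nonzero and the content vanishes;
prescribing further entries only shrinks a set of density zero. -/
theorem hasMatrixDensity_delta_zero (hk : k ≤ min n m) (hkn : k < n) (d : Fin k → ℕ)
    (hd : ∃ i, d i = 0) : HasMatrixDensity (Delta hk d) 0 := by
  induction k with
  | zero => exact hd.choose.elim0
  | succ k ih =>
    have hsub : uncurried (Delta hk d) ⊆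
        uncurried (Delta ((Nat.le_succ k).trans hk) (Fin.init d)) := fun x hx => delta_init (hk := hk) hx
    by_cases hd' : ∀ i, Fin.init d i ≠ 0
    · obtain ⟨δ, h1, -⟩ := hasMatrixDensity_delta ((Nat.le_succ k).trans hk) (by omega) _ hd'
      have h3 := (deltaReduction hk _ hd').hasNaturalDensity_content_eq_zero h1 (by omega)
      have hl : d (Fin.last k) = 0 := by
        obtain ⟨i, hi⟩ := hd
        refine Fin.lastCases (fun h => h) (fun i h => absurd h (hd' i)) i hi
      rw [← uncurried_delta_snoc hk _ hd', ← hl, Fin.snoc_init_self] at h3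
      exact h3
    · push Not at hd'
      exact (ih ((Nat.le_succ k).trans hk) (by omega) (Fin.init d) hd').mono_zero hsub

theorem hasMatrixDensity_delta_modEq (hk : k + 1 ≤ min n m) (hkn : k + 1 = n) (d : Fin k → ℕ)
    {q : ℕ} (hq : q ≠ 0) (r : ℕ) : ∃ δ : ℝ,
      HasMatrixDensity (Delta ((Nat.le_succ k).trans hk) d) δ ∧
      HasMatrixDensity {A : Matrix (Fin n) (Fin m) ℤ | ∃ a : ℕ, a ≡ r [MOD q] ∧
        A ∈ Delta hk (Fin.snoc (α := fun _ => ℕ) d a)} (1 / (q : ℝ) * δ) := by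
  by_cases hd : ∀ i, d i ≠ 0
  · obtain ⟨δ, h1, -⟩ := hasMatrixDensity_delta ((Nat.le_succ k).trans hk) (by omega) d hd
    refine ⟨δ, h1, ?_⟩
    have h2 := (deltaReduction hk d hd).hasNaturalDensity_content_modEq h1 hkn hq r
    rw [one_div, inv_mul_eq_div]
    refine (congrArg (HasNaturalDensity · (δ / q)) ?_).mp h2
    ext x
    have h3 := fun a => Set.ext_iff.1 (uncurried_delta_snoc (n := n) (m := m) hk d hd a) x
    constructor
    · rintro ⟨hx, hr⟩
      exact ⟨_, hr, (h3 _).2 ⟨hx, rfl⟩⟩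
    · rintro ⟨a, ha, hx⟩
      obtain ⟨h4, rfl⟩ := (h3 a).1 hx
      exact ⟨h4, ha⟩
  · push Not at hd
    have h1 := hasMatrixDensity_delta_zero ((Nat.le_succ k).trans hk) (by omega) d hd
    refine ⟨0, h1, ?_⟩
    rw [mul_zero]
    refine h1.mono_zero ?_
    rintro x ⟨a, -, hx⟩
    have := delta_init hx
    rwa [Fin.init_snoc] at this

end

end HermiteDensity

theorem mainTheorem1 (n m : ℕ) (hn : 0 < n) (hm : 0 < m) :
    (∀ (k : ℕ) (hk : 0 < k) (h₁ : m < n → k ≤ m) (h₂ : n ≤ m → k < n) (d : Fin k → ℕ),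
      (d ⟨k - 1, Nat.sub_one_lt_of_lt hk⟩ = 0 →
        HermiteDensity.HasMatrixDensity
          (HermiteDensity.Delta (HermiteDensity.le_min_of_range h₁ h₂) d) 0) ∧
      ((∀ i, d i ≠ 0) →
        ∃ δ : ℝ,
          HermiteDensity.HasMatrixDensity
            (HermiteDensity.Delta (HermiteDensity.le_min_of_range h₁ h₂) d) δ ∧
          (δ : ℂ) = ((∏ i : Fin k, riemannZeta ((n - (i : ℕ) : ℕ) : ℂ)) *
            ∏ i : Fin k, (d i : ℂ) ^ (n - (i : ℕ)))⁻¹)) ∧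
    (∀ (hnm : n ≤ m) (d : Fin (n - 1) → ℕ) (q r : ℕ), r < q →
      ∃ δ : ℝ,
        HermiteDensity.HasMatrixDensity
          (HermiteDensity.Delta (HermiteDensity.pred_le_min hnm) d) δ ∧
        HermiteDensity.HasMatrixDensity
          {A : Matrix (Fin n) (Fin m) ℤ | ∃ a : ℕ, a ≡ r [MOD q] ∧
            A ∈ HermiteDensity.Delta (HermiteDensity.pred_add_one_le_min hn hnm)
              (Fin.snoc (α := fun _ => ℕ) d a)}
          (1 / (q : ℝ) * δ)) := by
  refine ⟨fun k hk h₁ h₂ d => ?_, fun hnm d q r hr => ?_⟩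
  · have hkn : k < n := by omega
    exact ⟨fun h => HermiteDensity.hasMatrixDensity_delta_zero _ hkn d ⟨_, h⟩,
      fun h => HermiteDensity.hasMatrixDensity_delta _ hkn d h⟩
  · exact HermiteDensity.hasMatrixDensity_delta_modEq
      (HermiteDensity.pred_add_one_le_min hn hnm) (by omega) d (by omega) r
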